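/- Let $T$ be a text of $n\ge 2$ tokens, let $f(t,T)$ be the number of occurrences of a token $t$ in $T$ and $f_T=\max_{t\in T} f(t,T)$. Let $h$ be a hash function that assigns a non-negative integer $h(t,x)$ to a token $t$ and an integer $x\ge1$. A *key* is a pair $(p,q)$ with $1\le p\le q\le n$ and $T[p]=T[q]$; its hash value is $h(t,x)$, where $t=T[q]$ and $x$ is the number of occurrences of $t$ in $T[p,q]$. The key is *active* if $h(t,x)<h(t,x')$ for all $1\le x'<x$; $X(T)$ is the set of active keys. A key $(p,q)$ *dominates* $(p',q')\neq(p,q)$ if $p'\le p$ and $q\le q'$. Monotonic partitioning is the following algorithm. Step 1 generates a list $K$ of keys with their hash values: first the array $A$ of positions of every distinct token $t$ is collected, in a map kept in a balanced search tree; then *GenerateKeys* lists $(A[i],A[j],h(t,j-i+1))$ for every $t$ and all $1\le i\le j\le|A|$, whereas *GenerateActiveKeys* runs, for every $t$, through $x=1,\dots,|A|$, maintaining the smallest value $h(t,x)$ seen so far, and only if $h(t,x)$ is strictly smaller than all earlier ones lists $(A[i],A[i+x-1],h(t,x))$ for $1\le i\le|A|-x+1$. Step 2 sets $S=\{(0,0),(n+1,n+1)\}$,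 kept in lexicographic order in a self-balancing binary search tree, $S[k]$ being its $k$-th element with coordinates $S[k].x$, $S[k].y$. Step 3 visits the keys $(b,c)$ of $K$ in ascending order of hash value $v$: find by binary search the largest $j'$ with $S[j'].y\le c$; if $S[j']$ dominates $(b,c)$, skip the key; otherwise find by binary search the largest $i$ with $S[i].y<c$ and the smallest $j$ with $S[j].x>b$, put $c'=c$, and for $k=i,\dots,j-1$ put $a=S[k].x+1$, $d=S[k+1].y-1$, output the window $(v,a,b,c',d)$ if $a\le b$ and $c'\le d$, and set $c'=S[k+1].y$; then remove $S[i+1],\dots,S[j-1]$ from $S$ and insert $(b,c)$. Time is the number of elementary steps of a unit-cost random access machine (a comparison or arithmetic operation, a hash evaluation, an array access, an amortized append, or following a pointer is $O(1)$ steps); space is the peak number of memory cells in use, counting the text, all data structures, the call stack and the output. There is an absolute constant behind the following $O$'s. 1. For every $h$, the algorithm with GenerateActiveKeys takes $O(|X(T)|\log n)$ time and $O(|X(T)|)$ space. 2. If $h$ is a random hash function, i.e. almost surely no two of the values $h(t,x)$ with $t\in T$, $1\le x\le f(t,T)$ collide and the joint law of these values is invariant under permutations of the arguments $(t,x)$,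 then the algorithm with GenerateActiveKeys takes, in expectation, $O(n\log n+n\log n\log f_T)$ time and $O(n+n\log f_T)$ space. 3. For every $h$, the algorithm with GenerateKeys takes $O(n f_T\log n)$ time and $O(n f_T)$ space. -/

import Mathlib

open MeasureTheory ProbabilityTheory

namespace TextAlign

/-! ### Cost model

Unit-cost random access machine.  A value of type `Run β` is the record of one terminating
execution: its result, the number of elementary steps, the change in the number of occupied
memory cells, and the peak number of cells occupied at the same time (beyond those occupied
when it started).  A cell is a block of boundedly many machine words: a tree node, a list cell, an
array entry or the frame of a procedure call.  The programs further below touch their data only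
through the primitives of this section. -/

structure Run (β : Type) where
  val : β
  time : ℕ
  net : ℤ
  peak : ℕ

instance : Monad Run where
  pure a := ⟨a, 0, 0, 0⟩
  bind m f :=
    ⟨(f m.val).val, m.time + (f m.val).time, m.net + (f m.val).net,
      max m.peak (m.net + ((f m.val).peak : ℤ)).toNat⟩

/-- One elementary step with result `a`. -/
def step {β : Type} (a : β) : Run β := ⟨a, 1, 0, 0⟩

/-- One elementary step: a jump, or following a pointer. -/
def tick : Run Unit := step ()

/-- Occupy `k` new cells. -/
def alloc (k : ℕ) : Run Unit := ⟨(), k, k, k⟩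

/-- Release one cell. -/
def free : Run Unit := ⟨(), 1, -1, 0⟩

/-- A procedure call: its frame occupies one cell until it returns. -/
def call {β : Type} (m : Run β) : Run β := do
  alloc 1
  let r ← m
  free
  return r

def addN (a b : ℕ) : Run ℕ := step (a + b)
def subN (a b : ℕ) : Run ℕ := step (a - b)
def maxN (a b : ℕ) : Run ℕ := step (max a b)
def le {β : Type} [LinearOrder β] (a b : β) : Run Bool := step (decide (a ≤ b))
def lt {β : Type} [LinearOrder β] (a b : β) : Run Bool := step (decide (a < b))
def eq {β : Type} [LinearOrder β] (a b : β) : Run Bool := step (decide (a = b))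

/-- One evaluation of the hash function. -/
def hash {α : Type} (h : α → ℕ → ℕ) (t : α) (x : ℕ) : Run ℕ := step (h t x)

/-- Entry `i` (counted from 0) of an array. -/
def read (A : Array ℕ) (i : ℕ) : Run ℕ := step (A.getD i 0)

/-- Append an entry to a growable array, at the amortized cost of doubling its capacity when full. -/
def append (A : Array ℕ) (a : ℕ) : Run (Array ℕ) := do
  alloc 1
  step (A.push a)

/-- Add an element at the front of a linked list. -/
def cons {β : Type} (a : β) (l : List β) : Run (List β) := do
  alloc 1
  step (a :: l)

/-- `for i = lo, …, lo + cnt - 1 do s ← f i s`. -/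
def forRange {σ : Type} : ℕ → ℕ → σ → (ℕ → σ → Run σ) → Run σ
  | _, 0, s, _ => do
    tick
    return s
  | lo, cnt + 1, s, f => do
    tick
    let s' ← f lo s
    forRange (lo + 1) cnt s' f

/-- `for a in l do s ← f a s`. -/
def forList {β σ : Type} : List β → σ → (β → σ → Run σ) → Run σ
  | [], s, _ => do
    tick
    return s
  | a :: l, s, f => do
    tick
    let s' ← f a s
    forList l s' f

/-! ### A self-balancing binary search tree

Height-balanced (AVL) trees; every node also stores the size of its subtree, so that the elements
can be addressed by their index (from 0) in the in-order sequence.  Updates are done in place: the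
nodes on the search path are overwritten, and only insertion and removal of an element occupy or
release a cell. -/

inductive AVL (β : Type) where
  | nil : AVL β
  | node (l : AVL β) (a : β) (r : AVL β) (ht sz : ℕ) : AVL β

namespace AVL

variable {β : Type}

/-- The stored height. -/
def ht : AVL β → ℕ
  | nil => 0
  | node _ _ _ k _ => k

/-- The stored size. -/
def sz : AVL β → ℕ
  | nil => 0
  | node _ _ _ _ k => k

/-- Overwrite a node with new children and an element, and recompute the stored height and size. -/
def mk (l : AVL β) (a : β) (r : AVL β) : Run (AVL β) := do
  let m ← maxN l.ht r.ht
  let k ← addN m 1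
  let u ← addN l.sz r.sz
  let s ← addN u 1
  step (node l a r k s)

/-- `mk`, followed by the AVL rotation that restores balance when the heights of `l` and `r` differ
by 2. -/
def bal (l : AVL β) (a : β) (r : AVL β) : Run (AVL β) := do
  let hl ← addN l.ht 1
  let hr ← addN r.ht 1
  if ← lt hr l.ht then
    tick
    match l with
    | nil => mk l a r
    | node ll la lr _ _ =>
      if ← le lr.ht ll.ht then
        let r' ← mk lr a r
        mk ll la r'
      else
        tick
        match lr with
        | nil => mk l a r
        | node lrl lra lrr _ _ =>
          let l' ← mk ll la lrl
          let r' ← mk lrr a r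
          mk l' lra r'
  else if ← lt hl r.ht then
    tick
    match r with
    | nil => mk l a r
    | node rl ra rr _ _ =>
      if ← le rl.ht rr.ht then
        let l' ← mk l a rl
        mk l' ra rr
      else
        tick
        match rl with
        | nil => mk l a r
        | node rll rla rlr _ _ =>
          let l' ← mk l a rll
          let r' ← mk rlr ra rr
          mk l' rla r'
  else
    mk l a r

/-- Insert `x` so that it gets index `i`. -/
def insertAt : AVL β → ℕ → β → Run (AVL β)
  | nil, _, x => do
    alloc 1
    mk nil x nil
  | node l a r _ _, i, x => call do
    if ← le i l.sz then
      let l' ← insertAt l i x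
      bal l' a r
    else
      let i' ← subN i l.sz
      let i'' ← subN i' 1
      let r' ← insertAt r i'' x
      bal l a r'

/-- Remove the first element of the tree with root `a` and subtrees `l`, `r`; return it together
with the remaining tree. -/
def popMin : AVL β → β → AVL β → Run (β × AVL β)
  | nil, a, r => do
    tick
    free
    return (a, r)
  | node ll la lr _ _, a, r => call do
    let (m, l') ← popMin ll la lr
    let t ← bal l' a r
    return (m, t)

/-- Remove the element of index `i`. -/
def removeAt : AVL β → ℕ → Run (AVL β)
  | nil, _ => do
    tick
    return nil
  | node l a r _ _, i => call do
    if ← lt i l.sz then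
      let l' ← removeAt l i
      bal l' a r
    else if ← lt l.sz i then
      let i' ← subN i l.sz
      let i'' ← subN i' 1
      let r' ← removeAt r i''
      bal l a r'
    else
      tick
      match r with
      | nil => do
        free
        return l
      | node rl ra rr _ _ => do
        let (m, r') ← popMin rl ra rr
        bal l m r'

/-- The element of index `i`. -/
def get? : AVL β → ℕ → Run (Option β)
  | nil, _ => do
    tick
    return none
  | node l a r _ _, i => do
    tick
    if ← lt i l.sz then
      get? l i
    else if ← lt l.sz i then
      let i' ← subN i l.sz
      let i'' ← subN i' 1
      get? r i''
    else
      return some a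

/-- Overwrite the element of index `i`. -/
def setAt : AVL β → ℕ → β → Run (AVL β)
  | nil, _, _ => do
    tick
    return nil
  | node l a r k s, i, x => call do
    if ← lt i l.sz then
      let l' ← setAt l i x
      step (node l' a r k s)
    else if ← lt l.sz i then
      let i' ← subN i l.sz
      let i'' ← subN i' 1
      let r' ← setAt r i'' x
      step (node l a r' k s)
    else
      step (node l x r k s)

/-- Binary search: `acc` plus the number of elements satisfying `p`, for a tree in whose in-order
sequence the elements satisfying `p` precede all the others. -/
def search (p : β → Run Bool) : AVL β → ℕ → Run ℕ
  | nil, acc => do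
    tick
    return acc
  | node l a r _ _, acc => do
    tick
    if ← p a then
      let u ← addN acc l.sz
      let acc' ← addN u 1
      search p r acc'
    else
      search p l acc

/-- The in-order sequence as a linked list, in front of `acc`. -/
def toList : AVL β → List β → Run (List β)
  | nil, acc => do
    tick
    return acc
  | node l a r _ _, acc => call do
    let rest ← toList r acc
    let rest' ← cons a rest
    toList l rest'

end AVL

/-! ### The algorithms -/

/-- A key `(p, q)` with its hash value `v`. -/
structure HKey where
  p : ℕ
  q : ℕ
  v : ℕ

/-- The compact window `⟨T, h, v, a, b, c, d⟩` of the text and hash function at hand. -/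
structure Window where
  v : ℕ
  a : ℕ
  b : ℕ
  c : ℕ
  d : ℕ

variable {α : Type} [LinearOrder α]

/-- `map`: the distinct tokens in order, each with the array of its positions. -/
abbrev PosMap (α : Type) : Type := AVL (α × Array ℕ)

/-- Append `i` to `map[t]`. -/
def addPosition (map : PosMap α) (t : α) (i : ℕ) : Run (PosMap α) := do
  let k ← AVL.search (fun e => lt e.1 t) map 0
  match ← AVL.get? map k with
  | none =>
    let A ← append #[] i
    AVL.insertAt map k (t, A)
  | some (t', A) =>
    if ← eq t' t then
      let A' ← append A i
      AVL.setAt map k (t, A')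
    else
      let A' ← append #[] i
      AVL.insertAt map k (t, A')

/-- The inverted index of the positions `1, …, n` of the tokens, as a list of entries `(t, A)`. -/
def buildMap (T : List α) : Run (List (α × Array ℕ)) := do
  let (map, _) ← forList T ((AVL.nil : PosMap α), 1) fun t (map, i) => do
    let map' ← addPosition map t i
    let i' ← addN i 1
    return (map', i')
  AVL.toList map []

/-- `GenerateKeys`. -/
def generateKeys (T : List α) (h : α → ℕ → ℕ) : Run (List HKey) := do
  let entries ← buildMap T
  forList entries [] fun (t, A) K =>
    forRange 0 A.size K fun i K => do
      let cnt ← subN A.size i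
      forRange i cnt K fun j K => do
        let p ← read A i
        let q ← read A j
        let m ← subN j i
        let x ← addN m 1
        let v ← hash h t x
        cons ⟨p, q, v⟩ K

/-- `GenerateActiveKeys`. -/
def generateActiveKeys (T : List α) (h : α → ℕ → ℕ) : Run (List HKey) := do
  let entries ← buildMap T
  forList entries [] fun (t, A) K => do
    let (K, _) ← forRange 1 A.size (K, (⊤ : WithTop ℕ)) fun x (K, minkey) => do
      let v ← hash h t x
      if ← lt (v : WithTop ℕ) minkey then
        let m ← addN A.size 1
        let cnt ← subN m x
        let K' ← forRange 0 cnt K fun i K => do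
          let u ← addN i x
          let e ← subN u 1
          let p ← read A i
          let q ← read A e
          cons ⟨p, q, v⟩ K
        return (K', (v : WithTop ℕ))
      else
        return (K, minkey)
    return K

/-- The keys in ascending order of the hash value, sorted by insertion into a balanced tree. -/
def sortKeys (K : List HKey) : Run (List HKey) := do
  let t ← forList K (AVL.nil : AVL HKey) fun s t => do
    let k ← AVL.search (fun s' => le s'.v s.v) t 0
    AVL.insertAt t k s
  AVL.toList t []

/-- `(p, q)` dominates `(p', q')`, i.e. `[p, q] ⊂ [p', q']`. -/
def dominates (s s' : ℕ × ℕ) : Run Bool := do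
  if ← le s'.1 s.1 then
    if ← le s.2 s'.2 then
      if ← eq s.1 s'.1 then
        if ← eq s.2 s'.2 then
          return false
        else
          return true
      else
        return true
    else
      return false
  else
    return false

/-- One round of the main loop: visit the key `(b, c)` of hash value `v`, with the skyline `S` in
coordinate order and the windows `P` generated so far. -/
def visit (key : HKey) (S : AVL (ℕ × ℕ)) (P : List Window) :
    Run (AVL (ℕ × ℕ) × List Window) := do
  let b := key.p
  let c := key.q
  let cnt' ← AVL.search (fun s => le s.2 c) S 0
  let j' ← subN cnt' 1
  let sj ← AVL.get? S j'
  if ← dominates (sj.getD (0, 0)) (b, c) then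
    return (S, P)
  else
    let cnt ← AVL.search (fun s => lt s.2 c) S 0
    let i ← subN cnt 1
    let j ← AVL.search (fun s => le s.1 b) S 0
    let len ← subN j i
    let (P', _) ← forRange i len (P, c) fun k (P, c') => do
      let sk ← AVL.get? S k
      let k' ← addN k 1
      let sk' ← AVL.get? S k'
      let a ← addN (sk.getD (0, 0)).1 1
      let d ← subN (sk'.getD (0, 0)).2 1
      if ← le a b then
        if ← le c' d then
          let P' ← cons ⟨key.v, a, b, c', d⟩ P
          return (P', (sk'.getD (0, 0)).2)
        else
          return (P, (sk'.getD (0, 0)).2)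
      else
        return (P, (sk'.getD (0, 0)).2)
    let i' ← addN i 1
    let rem ← subN j i'
    let S' ← forRange i' rem S fun _ S => AVL.removeAt S i'
    let S'' ← AVL.insertAt S' i' (b, c)
    return (S'', P')

/-- `MonotonicPartitioning`, with the procedure that generates the keys as a parameter.  The text
itself occupies `n` cells. -/
def monotonicPartitioning (gen : List α → (α → ℕ → ℕ) → Run (List HKey))
    (T : List α) (h : α → ℕ → ℕ) : Run (List Window) := do
  alloc T.length
  let K ← gen T h
  let n1 ← addN T.length 1
  let S₀ ← AVL.insertAt AVL.nil 0 ((0, 0) : ℕ × ℕ)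
  let S₁ ← AVL.insertAt S₀ 1 (n1, n1)
  let order ← sortKeys K
  let (_, P) ← forList order (S₁, ([] : List Window)) fun key (S, P) => visit key S P
  return P

/-- `MonotonicPartitioning` with `GenerateActiveKeys`. -/
def monoActive (T : List α) (h : α → ℕ → ℕ) : Run (List Window) :=
  monotonicPartitioning generateActiveKeys T h

/-- `MonotonicPartitioning` with `GenerateKeys`. -/
def monoAll (T : List α) (h : α → ℕ → ℕ) : Run (List Window) :=
  monotonicPartitioning generateKeys T h

/-! ### Active keys, maximum frequency, random hash functions -/

/-- `T[p, q]`, with positions counted from 1. -/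
def slice (T : List α) (p q : ℕ) : List α := (T.take q).drop (p - 1)

/-- `(p, q)` is a key of `T`. -/
def IsKey (T : List α) (p q : ℕ) : Prop :=
  1 ≤ p ∧ p ≤ q ∧ q ≤ T.length ∧ T[p - 1]? = T[q - 1]?

/-- The hash value `h(t, x)` is active. -/
def IsActiveHash (h : α → ℕ → ℕ) (t : α) (x : ℕ) : Prop :=
  ∀ x', 1 ≤ x' → x' < x → h t x < h t x'

/-- `(p, q)` is an active key of `T`. -/
def IsActiveKey (T : List α) (h : α → ℕ → ℕ) (p q : ℕ) : Prop :=
  IsKey T p q ∧ ∃ t, T[q - 1]? = some t ∧ IsActiveHash h t ((slice T p q).count t)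

open Classical in
/-- The set `X(T)` of active keys. -/
noncomputable def activeKeys (T : List α) (h : α → ℕ → ℕ) : Finset (ℕ × ℕ) :=
  (Finset.Icc 1 T.length ×ˢ Finset.Icc 1 T.length).filter fun s => IsActiveKey T h s.1 s.2

/-- The maximum token frequency `f_T`. -/
def maxFreq (T : List α) : ℕ := T.toFinset.sup fun t => T.count t

/-- The arguments `(t, x)` whose hash values occur in `T`: `t ∈ T` and `1 ≤ x ≤ f(t, T)`. -/
def hashArgs (T : List α) : Set (α × ℕ) := {e | e.1 ∈ T ∧ 1 ≤ e.2 ∧ e.2 ≤ T.count e.1}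

/-- `H` is an (ideal) random hash function on the arguments occurring in `T`: no two hash values
collide, and the joint law of the hash values is invariant under permuting the arguments.  For
instance, `H` may be a uniformly random injection of the arguments into `{0, …, M - 1}`. -/
structure IsRandomHash {Ω : Type*} [MeasurableSpace Ω] (μ : Measure Ω) (T : List α)
    (H : Ω → α → ℕ → ℕ) : Prop where
  noCollision : ∀ᵐ ω ∂μ, Set.InjOn (fun e : α × ℕ => H ω e.1 e.2) (hashArgs T)
  exchangeable : ∀ σ : Equiv.Perm (hashArgs T),
    IdentDistrib (fun ω (e : hashArgs T) => H ω e.1.1 e.1.2)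
      (fun ω (e : hashArgs T) => H ω (σ e).1.1 (σ e).1.2) μ μ

end TextAlign

/-!
Replacing a range of `S` by one element changes the number of windows by the number of elements
removed, so with the size of `S` as a potential each key pays for `O(1)` tree operations of
`O(log n)` steps, plus the windows it emits; all data structures and the output have size linear in
the number of generated keys. A token with `m` occurrences contributes `m + 1 - x` keys for every
`x ≤ m` whose hash value is a new strict minimum of `h(t,1), h(t,2), …`. By exchangeability each of
the first `x` values is their unique minimum with the same probability, hence with probability at
most `1/x`, and `∑ (m + 1 - x)/x ≤ m (1 + log m)`.
-/

namespace TextAlign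

/-! ### Step and cell budgets -/

namespace Run

variable {β γ : Type}

/-- The budget specification of an execution: started with `t` steps and `c` free cells at its
disposal, `m` never overdraws either account and leaves at least `t'` steps and `c'` cells.  Since
`c' > c` is allowed, it also covers executions that release cells. -/
structure Fits (m : Run β) (t c t' c' : ℕ) : Prop where
  time_le : m.time + t' ≤ t
  net_le : m.net + c' ≤ c
  peak_le : m.peak ≤ c

@[simp] theorem pure_val (a : β) : (pure a : Run β).val = a := rfl

@[simp] theorem bind_val (m : Run β) (f : β → Run γ) : (m >>= f).val = (f m.val).val := rfl

@[simp] theorem step_val (a : β) : (step a).val = a := rfl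

@[simp] theorem step_bind_val (a : β) (f : β → Run γ) : (step a >>= f).val = (f a).val := rfl

theorem bind_time (m : Run β) (f : β → Run γ) :
    (m >>= f).time = m.time + (f m.val).time := rfl

theorem bind_net (m : Run β) (f : β → Run γ) : (m >>= f).net = m.net + (f m.val).net := rfl

theorem bind_peak (m : Run β) (f : β → Run γ) :
    (m >>= f).peak = max m.peak (m.net + ((f m.val).peak : ℤ)).toNat := rfl

end Run

namespace Run.Fits

variable {β γ : Type} {m : Run β} {f : β → Run γ} {t c t' c' : ℕ}

theorem mono (hm : m.Fits t c t' c') {T C T' C' : ℕ} (ht : t + T' ≤ T + t') (hc : c ≤ C)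
    (hc' : c + C' ≤ C + c') : m.Fits T C T' C' := by
  obtain ⟨htime, hnet, hpeak⟩ := hm
  constructor <;> omega

theorem add_steps (hm : m.Fits t c t' c') (k : ℕ) : m.Fits (t + k) c (t' + k) c' :=
  hm.mono (by omega) le_rfl le_rfl

theorem bind {t₁ c₁ : ℕ} (hm : m.Fits t c t₁ c₁) (hf : (f m.val).Fits t₁ c₁ t' c') :
    (m >>= f).Fits t c t' c' := by
  obtain ⟨mtime, mnet, mpeak⟩ := hm
  obtain ⟨ftime, fnet, fpeak⟩ := hf
  constructor
  · rw [bind_time]; omega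
  · rw [bind_net]; omega
  · rw [bind_peak]; omega

theorem bind_of {u d u' d' T C T' C' : ℕ} (hm : m.Fits t c t' c')
    (hf : (f m.val).Fits u d u' d') (ht : t + u + T' ≤ T + t' + u') (hm_le : c ≤ C)
    (hf_le : c + d ≤ C + c') (hnet : c + d + C' ≤ C + c' + d') : (m >>= f).Fits T C T' C' := by
  obtain ⟨mtime, mnet, mpeak⟩ := hm
  obtain ⟨ftime, fnet, fpeak⟩ := hf
  constructor
  · rw [bind_time]; omega
  · rw [bind_net]; omega
  · rw [bind_peak]; omega

end Run.Fits

section Primitives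

variable {β γ : Type} {t c t' c' : ℕ}

@[simp] theorem pure_fits_iff (a : β) : (pure a : Run β).Fits t c t' c' ↔ t' ≤ t ∧ c' ≤ c := by
  refine ⟨fun ⟨htime, hnet, _⟩ => ?_, fun ⟨_, _⟩ => ⟨?_, ?_, Nat.zero_le c⟩⟩
  · change 0 + t' ≤ t at htime
    change (0 : ℤ) + c' ≤ c at hnet
    omega
  · change 0 + t' ≤ t
    omega
  · change (0 : ℤ) + c' ≤ c
    omega

@[simp] theorem step_bind_fits_iff (a : β) (f : β → Run γ) :
    (step a >>= f).Fits t c t' c' ↔ (f a).Fits t c (t' + 1) c' := by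
  have htime : (step a >>= f).time = 1 + (f a).time := rfl
  have hnet : (step a >>= f).net = 0 + (f a).net := rfl
  have hpeak : (step a >>= f).peak = max 0 (0 + ((f a).peak : ℤ)).toNat := rfl
  constructor <;> rintro ⟨_, _, _⟩ <;> constructor <;> omega

@[simp] theorem bind_pure_fits_iff (m : Run β) (g : β → γ) :
    (m >>= fun a => pure (g a)).Fits t c t' c' ↔ m.Fits t c t' c' := by
  have hnet : (m >>= fun a => pure (g a)).net = m.net + 0 := rfl
  have hpeak : (m >>= fun a => pure (g a)).peak = max m.peak (m.net + (0 : ℤ)).toNat := rfl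
  constructor <;> rintro ⟨_, _, _⟩ <;> constructor <;> omega

@[simp] theorem step_fits_iff (a : β) : (step a).Fits t c t' c' ↔ t' + 1 ≤ t ∧ c' ≤ c := by
  rw [← bind_pure_fits_iff (step a) id, step_bind_fits_iff, pure_fits_iff]

theorem alloc_fits (k : ℕ) : (alloc k).Fits (t + k) (c + k) t c := by
  have htime : (alloc k).time = k := rfl
  have hnet : (alloc k).net = k := rfl
  have hpeak : (alloc k).peak = k := rfl
  constructor <;> omega

theorem free_fits : free.Fits (t + 1) c t (c + 1) := by
  have htime : free.time = 1 := rfl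
  have hnet : free.net = -1 := rfl
  have hpeak : free.peak = 0 := rfl
  constructor <;> omega

@[simp] theorem call_val (m : Run β) : (call m).val = m.val := rfl

theorem call_fits {m : Run β} (hm : m.Fits t c (t' + 2) c') :
    (call m).Fits t (c + 1) t' (c' + 1) := by
  have htime : (call m).time = 1 + (m.time + (1 + 0)) := rfl
  have hnet : (call m).net = 1 + (m.net + (-1 + 0)) := rfl
  have hpeak : (call m).peak =
    max 1 (1 + (max m.peak (m.net + (max 0 (-1 + (0 : ℤ)).toNat : ℕ)).toNat : ℕ) : ℤ).toNat := rfl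
  obtain ⟨_, _, _⟩ := hm
  constructor <;> omega

@[simp] theorem cons_val (a : β) (l : List β) : (cons a l).val = a :: l := rfl

theorem cons_fits (a : β) (l : List β) : (cons a l).Fits (t + 2) (c + 1) t c :=
  (alloc_fits 1).bind ((step_fits_iff _).2 ⟨le_rfl, le_rfl⟩)

@[simp] theorem append_val (A : Array ℕ) (a : ℕ) : (append A a).val = A.push a := rfl

theorem append_fits (A : Array ℕ) (a : ℕ) : (append A a).Fits (t + 2) (c + 1) t c :=
  (alloc_fits 1).bind ((step_fits_iff _).2 ⟨le_rfl, le_rfl⟩)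

attribute [simp] tick addN subN maxN hash read

variable [LinearOrder β]

@[simp] theorem le_bind_ite (a b : β) (x y : Run γ) :
    (le a b >>= fun r => if r = true then x else y) =
      (tick >>= fun _ => if a ≤ b then x else y) := by
  by_cases h : a ≤ b <;> simp only [le, h, decide_true, decide_false] <;> rfl

@[simp] theorem lt_bind_ite (a b : β) (x y : Run γ) :
    (lt a b >>= fun r => if r = true then x else y) =
      (tick >>= fun _ => if a < b then x else y) := by
  by_cases h : a < b <;> simp only [lt, h, decide_true, decide_false] <;> rfl

@[simp] theorem eq_bind_ite (a b : β) (x y : Run γ) :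
    (eq a b >>= fun r => if r = true then x else y) =
      (tick >>= fun _ => if a = b then x else y) := by
  by_cases h : a = b <;> simp only [eq, h, decide_true, decide_false] <;> rfl

end Primitives

section Loops

variable {β σ : Type}

-- The physicist's method: `τ` and `κ` are the steps and cells still reserved when `k` rounds are
-- left, and each round must pay for itself out of the drop in these potentials.
theorem forRange_fits {f : ℕ → σ → Run σ} {I : ℕ → σ → Prop} {τ κ : ℕ → σ → ℕ} {lo cnt : ℕ}
    (round : ∀ i k s, i + (k + 1) = lo + cnt → I i s → I (i + 1) (f i s).val ∧
      (f i s).Fits (τ (k + 1) s) (κ (k + 1) s) (τ k (f i s).val + 1) (κ k (f i s).val))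
    {s : σ} (hs : I lo s) :
    I (lo + cnt) (forRange lo cnt s f).val ∧ (forRange lo cnt s f).Fits (τ cnt s + 1) (κ cnt s)
      (τ 0 (forRange lo cnt s f).val) (κ 0 (forRange lo cnt s f).val) := by
  induction cnt generalizing lo s with
  | zero => exact ⟨hs, (step_bind_fits_iff () _).2 ((pure_fits_iff _).2 ⟨le_rfl, le_rfl⟩)⟩
  | succ k ih =>
    obtain ⟨hI, hfits⟩ := round lo k s rfl hs
    obtain ⟨hI', hfits'⟩ := ih (fun i k s hi => round i k s (by omega)) hI
    refine ⟨by rwa [Nat.add_right_comm, Nat.add_assoc] at hI', ?_⟩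
    exact (step_bind_fits_iff () _).2
      ((hfits.add_steps 1).bind (hfits'.add_steps 1))

theorem forList_fits {f : β → σ → Run σ} {I : List β → σ → Prop} {τ κ : List β → σ → ℕ}
    (round : ∀ a l s, I (a :: l) s → I l (f a s).val ∧
      (f a s).Fits (τ (a :: l) s) (κ (a :: l) s) (τ l (f a s).val + 1) (κ l (f a s).val))
    {l : List β} {s : σ} (hs : I l s) :
    I [] (forList l s f).val ∧ (forList l s f).Fits (τ l s + 1) (κ l s)
      (τ [] (forList l s f).val) (κ [] (forList l s f).val) := by
  induction l generalizing s with
  | nil => exact ⟨hs, (step_bind_fits_iff () _).2 ((pure_fits_iff _).2 ⟨le_rfl, le_rfl⟩)⟩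
  | cons a l ih =>
    obtain ⟨hI, hfits⟩ := round a l s hs
    obtain ⟨hI', hfits'⟩ := ih hI
    exact ⟨hI', (step_bind_fits_iff () _).2
      ((hfits.add_steps 1).bind (hfits'.add_steps 1))⟩

end Loops

/-! ### AVL trees -/

namespace AVL

variable {β : Type}

/-- The in-order sequence, which is the list that a tree represents. -/
def inorder : AVL β → List β
  | nil => []
  | node l a r _ _ => inorder l ++ a :: inorder r

/-- The AVL invariant: the tree is height-balanced and the stored heights and sizes are correct. -/
inductive WF : AVL β → Prop
  | nil : WF nil
  | node {l r : AVL β} {a : β} (hl : WF l) (hr : WF r) (hlr : l.ht ≤ r.ht + 1)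
      (hrl : r.ht ≤ l.ht + 1) : WF (node l a r (max l.ht r.ht + 1) (l.sz + r.sz + 1))

@[simp] theorem inorder_nil : (nil : AVL β).inorder = [] := rfl

@[simp] theorem inorder_node (l : AVL β) (a : β) (r : AVL β) (k s : ℕ) :
    (node l a r k s).inorder = l.inorder ++ a :: r.inorder := rfl

@[simp] theorem ht_nil : (nil : AVL β).ht = 0 := rfl

@[simp] theorem ht_node (l : AVL β) (a : β) (r : AVL β) (k s : ℕ) : (node l a r k s).ht = k := rfl

@[simp] theorem sz_node (l : AVL β) (a : β) (r : AVL β) (k s : ℕ) : (node l a r k s).sz = s := rfl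

theorem WF.length_inorder {t : AVL β} (h : t.WF) : t.inorder.length = t.sz := by
  induction h with
  | nil => rfl
  | node _ _ _ _ ihl ihr =>
    rw [inorder_node, List.length_append, List.length_cons, ihl, ihr]
    rfl

theorem WF.ht_le_sz {t : AVL β} (h : t.WF) : t.ht ≤ t.sz := by
  induction h with
  | nil => exact Nat.le_refl 0
  | node _ _ _ _ ihl ihr =>
    rw [ht_node, sz_node]
    omega

theorem WF.two_pow_le {t : AVL β} (h : t.WF) : 2 ^ (t.ht / 2) ≤ t.sz + 1 := by
  induction h with
  | nil => simp
  | @node l r _ _ _ hlr hrl ihl ihr =>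
    rw [ht_node, sz_node]
    cases hm : (max l.ht r.ht + 1) / 2 with
    | zero => omega
    | succ m =>
      have hleft : 2 ^ m ≤ 2 ^ (l.ht / 2) := Nat.pow_le_pow_right two_pos (by omega)
      have hright : 2 ^ m ≤ 2 ^ (r.ht / 2) := Nat.pow_le_pow_right two_pos (by omega)
      rw [pow_succ]
      omega

theorem WF.ht_le_log {t : AVL β} (h : t.WF) {M : ℕ} (hM : t.sz + 1 ≤ M) :
    t.ht ≤ 2 * Nat.log 2 M + 1 := by
  have := Nat.le_log_of_pow_le Nat.one_lt_two (h.two_pow_le.trans hM)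
  omega

section Rebalancing

variable {l r : AVL β} {a : β}

@[simp] theorem mk_val : (mk l a r).val = node l a r (max l.ht r.ht + 1) (l.sz + r.sz + 1) := rfl

@[simp] theorem mk_fits_iff {t c t' c' : ℕ} :
    (mk l a r).Fits t c t' c' ↔ t' + 5 ≤ t ∧ c' ≤ c := by
  simp only [mk, maxN, addN, step_bind_fits_iff, step_fits_iff, Nat.add_assoc, Nat.reduceAdd]

@[simp] theorem mk_bind_fits_iff {γ : Type} {f : AVL β → Run γ} {t c t' c' : ℕ} :
    (mk l a r >>= f).Fits t c t' c' ↔ (f (mk l a r).val).Fits t c (t' + 5) c' := by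
  have htime : (mk l a r >>= f).time = 5 + (f (mk l a r).val).time := rfl
  have hnet : (mk l a r >>= f).net = 0 + (f (mk l a r).val).net := rfl
  have hpeak : (mk l a r >>= f).peak = max 0 (0 + ((f (mk l a r).val).peak : ℤ)).toNat := rfl
  constructor <;> rintro ⟨_, _, _⟩ <;> constructor <;> omega

theorem bal_val_of_balanced (hlr : l.ht ≤ r.ht + 1) (hrl : r.ht ≤ l.ht + 1) :
    (bal l a r).val = node l a r (max l.ht r.ht + 1) (l.sz + r.sz + 1) := by
  simp [bal, hlr.not_gt, hrl.not_gt]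

theorem bal_inorder : (bal l a r).val.inorder = l.inorder ++ a :: r.inorder := by
  by_cases hleft : r.ht + 1 < l.ht
  · rcases l with _ | ⟨ll, _, lr, _, _⟩
    · cases hleft
    rw [ht_node] at *
    by_cases hsingle : lr.ht ≤ ll.ht
    · simp [bal, *]
    rcases lr with _ | ⟨_, _, _, _, _⟩
    · exact absurd (Nat.zero_le _) hsingle
    · rw [ht_node] at *
      simp [bal, *]
  by_cases hright : l.ht + 1 < r.ht
  · rcases r with _ | ⟨rl, _, rr, _, _⟩
    · cases hright
    rw [ht_node] at *
    by_cases hsingle : rl.ht ≤ rr.ht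
    · simp [bal, *]
    rcases rl with _ | ⟨_, _, _, _, _⟩
    · exact absurd (Nat.zero_le _) hsingle
    · rw [ht_node] at *
      simp [bal, *]
  · simp [bal, *]

theorem bal_fits : (bal l a r).Fits 25 0 0 0 := by
  by_cases hleft : r.ht + 1 < l.ht
  · rcases l with _ | ⟨ll, _, lr, _, _⟩
    · cases hleft
    rw [ht_node] at *
    by_cases hsingle : lr.ht ≤ ll.ht
    · simp [bal, *]
    rcases lr with _ | ⟨_, _, _, _, _⟩
    · exact absurd (Nat.zero_le _) hsingle
    · rw [ht_node] at *
      simp [bal, *]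
  by_cases hright : l.ht + 1 < r.ht
  · rcases r with _ | ⟨rl, _, rr, _, _⟩
    · cases hright
    rw [ht_node] at *
    by_cases hsingle : rl.ht ≤ rr.ht
    · simp [bal, *]
    rcases rl with _ | ⟨_, _, _, _, _⟩
    · exact absurd (Nat.zero_le _) hsingle
    · rw [ht_node] at *
      simp [bal, *]
  · simp [bal, *]

theorem bal_val_single_left {ll lr : AVL β} {b : β} {k s : ℕ} (h : r.ht + 1 < k)
    (hlr : lr.ht ≤ ll.ht) :
    (bal (node ll b lr k s) a r).val = (mk ll b (mk lr a r).val).val := by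
  simp [bal, h, hlr]

theorem bal_val_double_left {ll lrl lrr : AVL β} {b c : β} {k s k' s' : ℕ} (h : r.ht + 1 < k)
    (hlr : ¬k' ≤ ll.ht) :
    (bal (node ll b (node lrl c lrr k' s') k s) a r).val =
      (mk (mk ll b lrl).val c (mk lrr a r).val).val := by
  simp [bal, h, hlr]

theorem bal_val_single_right {rl rr : AVL β} {b : β} {k s : ℕ} (h : l.ht + 1 < k)
    (hrl : rl.ht ≤ rr.ht) :
    (bal l a (node rl b rr k s)).val = (mk (mk l a rl).val b rr).val := by
  have : ¬k + 1 < l.ht := by omega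
  simp [bal, this, h, hrl]

theorem bal_val_double_right {rll rlr rr : AVL β} {b c : β} {k s k' s' : ℕ} (h : l.ht + 1 < k)
    (hrl : ¬k' ≤ rr.ht) :
    (bal l a (node (node rll c rlr k' s') b rr k s)).val =
      (mk (mk l a rll).val c (mk rlr b rr).val).val := by
  have : ¬k + 1 < l.ht := by omega
  simp [bal, this, h, hrl]

theorem bal_wf_of_left (hl : l.WF) (hr : r.WF) (h : l.ht = r.ht + 2) :
    (bal l a r).val.WF ∧ l.ht ≤ (bal l a r).val.ht ∧ (bal l a r).val.ht ≤ l.ht + 1 := by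
  cases hl with
  | nil => cases h
  | @node ll lr _ hll hlr =>
    rw [ht_node] at *
    by_cases hsingle : lr.ht ≤ ll.ht
    · rw [bal_val_single_left (by omega) hsingle]
      refine ⟨.node hll (.node hlr hr ?_ ?_) ?_ ?_, ?_, ?_⟩ <;>
        (try simp only [mk_val, ht_node]) <;> omega
    cases hlr with
    | nil => exact absurd (Nat.zero_le _) hsingle
    | node hlrl hlrr =>
      rw [ht_node] at *
      rw [bal_val_double_left (by omega) hsingle]
      refine ⟨.node (.node hll hlrl ?_ ?_) (.node hlrr hr ?_ ?_) ?_ ?_, ?_, ?_⟩ <;>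
        (try simp only [mk_val, ht_node]) <;> omega

theorem bal_wf_of_right (hl : l.WF) (hr : r.WF) (h : r.ht = l.ht + 2) :
    (bal l a r).val.WF ∧ r.ht ≤ (bal l a r).val.ht ∧ (bal l a r).val.ht ≤ r.ht + 1 := by
  cases hr with
  | nil => cases h
  | @node rl rr _ hrl hrr =>
    rw [ht_node] at *
    by_cases hsingle : rl.ht ≤ rr.ht
    · rw [bal_val_single_right (by omega) hsingle]
      refine ⟨.node (.node hl hrl ?_ ?_) hrr ?_ ?_, ?_, ?_⟩ <;>
        (try simp only [mk_val, ht_node]) <;> omega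
    cases hrl with
    | nil => exact absurd (Nat.zero_le _) hsingle
    | node hrll hrlr =>
      rw [ht_node] at *
      rw [bal_val_double_right (by omega) hsingle]
      refine ⟨.node (.node hl hrll ?_ ?_) (.node hrlr hrr ?_ ?_) ?_ ?_, ?_, ?_⟩ <;>
        (try simp only [mk_val, ht_node]) <;> omega

theorem bal_wf (hl : l.WF) (hr : r.WF) (hlr : l.ht ≤ r.ht + 2) (hrl : r.ht ≤ l.ht + 2) :
    (bal l a r).val.WF ∧ max l.ht r.ht ≤ (bal l a r).val.ht ∧
      (bal l a r).val.ht ≤ max l.ht r.ht + 1 ∧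
      (l.ht ≤ r.ht + 1 → r.ht ≤ l.ht + 1 → (bal l a r).val.ht = max l.ht r.ht + 1) := by
  rcases hlr.lt_or_eq with hlr' | hleft
  · rcases hrl.lt_or_eq with hrl' | hright
    · rw [bal_val_of_balanced (by omega) (by omega)]
      exact ⟨.node hl hr (by omega) (by omega), Nat.le_succ _, le_rfl, fun _ _ => rfl⟩
    · obtain ⟨hwf, hle, hge⟩ := bal_wf_of_right (a := a) hl hr hright
      exact ⟨hwf, by omega, by omega, by omega⟩
  · obtain ⟨hwf, hle, hge⟩ := bal_wf_of_left (a := a) hl hr hleft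
    exact ⟨hwf, by omega, by omega, by omega⟩

end Rebalancing

variable {t l r : AVL β} {a x : β} {i k s : ℕ}

theorem insertAt_node_val_of_le (hi : i ≤ l.sz) :
    (insertAt (node l a r k s) i x).val = (bal (insertAt l i x).val a r).val := by
  simp [insertAt, hi]

theorem insertAt_node_val_of_lt (hi : l.sz < i) :
    (insertAt (node l a r k s) i x).val = (bal l a (insertAt r (i - l.sz - 1) x).val).val := by
  simp [insertAt, hi.not_ge]

theorem inorder_insertAt (h : t.WF) (i : ℕ) (x : β) :
    (insertAt t i x).val.inorder = t.inorder.take i ++ x :: t.inorder.drop i := by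
  induction h generalizing i with
  | nil => simp [insertAt]
  | @node l r a hl _ _ _ ihl ihr =>
    have hlen := hl.length_inorder
    rcases le_or_gt i l.sz with hi | hi
    · rw [insertAt_node_val_of_le hi, bal_inorder, ihl, inorder_node,
        List.take_append_of_le_length (by omega), List.drop_append_of_le_length (by omega),
        List.append_assoc, List.cons_append]
    · obtain ⟨j, rfl⟩ : ∃ j, i = l.inorder.length + (j + 1) := ⟨i - l.sz - 1, by omega⟩
      have hj : l.inorder.length + (j + 1) - l.sz - 1 = j := by omega
      rw [insertAt_node_val_of_lt hi, bal_inorder, ihr, hj, inorder_node]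
      simp [List.take_length_add_append, List.drop_length_add_append]

theorem insertAt_wf (h : t.WF) (i : ℕ) (x : β) : (insertAt t i x).val.WF ∧
    t.ht ≤ (insertAt t i x).val.ht ∧ (insertAt t i x).val.ht ≤ t.ht + 1 := by
  induction h generalizing i with
  | nil => exact ⟨.node .nil .nil (Nat.zero_le _) (Nat.zero_le _), Nat.zero_le _, le_rfl⟩
  | @node l r a hl hr _ _ ihl ihr =>
    rw [ht_node]
    rcases le_or_gt i l.sz with hi | hi
    · obtain ⟨hwf, _, _⟩ := ihl i
      obtain ⟨hwf', _, _, _⟩ := bal_wf (a := a) hwf hr (by omega) (by omega)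
      rw [insertAt_node_val_of_le hi]
      exact ⟨hwf', by omega, by omega⟩
    · obtain ⟨hwf, _, _⟩ := ihr (i - l.sz - 1)
      obtain ⟨hwf', _, _, _⟩ := bal_wf (a := a) hl hwf (by omega) (by omega)
      rw [insertAt_node_val_of_lt hi]
      exact ⟨hwf', by omega, by omega⟩

theorem sz_insertAt (h : t.WF) (i : ℕ) (x : β) : (insertAt t i x).val.sz = t.sz + 1 := by
  rw [← (insertAt_wf h i x).1.length_inorder, inorder_insertAt h, ← h.length_inorder]
  simp only [List.length_append, List.length_take, List.length_cons, List.length_drop]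
  omega

theorem insertAt_fits (h : t.WF) (i : ℕ) (x : β) :
    (insertAt t i x).Fits (31 * (t.ht + 1)) (t.ht + 1) 0 t.ht := by
  induction h generalizing i with
  | nil => exact (alloc_fits (t := 30) (c := 0) 1).bind (mk_fits_iff.2 ⟨by decide, le_rfl⟩)
  | node _ _ _ _ ihl ihr =>
    refine call_fits ?_
    rw [ht_node]
    simp only [le_bind_ite, tick, subN, step_bind_fits_iff]
    split_ifs
    · exact (ihl i).bind_of bal_fits (by omega) (by omega) (by omega) (by omega)
    · simp only [step_bind_fits_iff]
      exact (ihr _).bind_of bal_fits (by omega) (by omega) (by omega) (by omega)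

theorem cons_inorder_popMin (l : AVL β) (a : β) (r : AVL β) :
    (popMin l a r).val.1 :: (popMin l a r).val.2.inorder = l.inorder ++ a :: r.inorder := by
  induction l generalizing a r with
  | nil => rfl
  | node ll b lr k s ihl _ =>
    have hval : (popMin (node ll b lr k s) a r).val =
        ((popMin ll b lr).val.1, (bal (popMin ll b lr).val.2 a r).val) := rfl
    rw [hval, bal_inorder, inorder_node, ← List.cons_append, ihl]

theorem popMin_wf (h : (node l a r k s).WF) : (popMin l a r).val.2.WF ∧
    (popMin l a r).val.2.ht ≤ k ∧ k ≤ (popMin l a r).val.2.ht + 1 := by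
  induction l generalizing a r k s with
  | nil =>
    cases h with
    | node _ hr =>
      have hval : (popMin nil a r).val.2 = r := rfl
      rw [hval, ht_nil] at *
      exact ⟨hr, by omega, by omega⟩
  | node ll b lr kl sl ihl _ =>
    cases h with
    | node hl hr =>
      obtain ⟨hwf, _, _⟩ := ihl hl
      rw [ht_node] at *
      obtain ⟨hwf', _, _, _⟩ := bal_wf (a := a) hwf hr (by omega) (by omega)
      have hval : (popMin (node ll b lr kl sl) a r).val.2 =
        (bal (popMin ll b lr).val.2 a r).val := rfl
      rw [hval]
      exact ⟨hwf', by omega, by omega⟩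

theorem popMin_fits (h : (node l a r k s).WF) : (popMin l a r).Fits (31 * k) k 0 (k + 1) := by
  induction l generalizing a r k s with
  | nil =>
    cases h with
    | node _ _ =>
      simp only [popMin, tick, step_bind_fits_iff, bind_pure_fits_iff]
      exact free_fits.mono (t := 1) (c := 0) (t' := 0) (by omega) (by omega) (by omega)
  | node ll b lr kl sl ihl _ =>
    cases h with
    | node hl hr =>
      refine call_fits ?_
      rw [ht_node] at *
      exact (ihl hl).bind_of ((bind_pure_fits_iff _ _).2 bal_fits) (by omega) (by omega) (by omega)
        (by omega)

theorem removeAt_node_val_of_lt (hi : i < l.sz) :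
    (removeAt (node l a r k s) i).val = (bal (removeAt l i).val a r).val := by
  simp [removeAt, hi]

theorem removeAt_node_val_of_gt (hi : l.sz < i) :
    (removeAt (node l a r k s) i).val = (bal l a (removeAt r (i - l.sz - 1)).val).val := by
  simp [removeAt, hi, hi.not_gt]

theorem removeAt_node_nil_val : (removeAt (node l a nil k s) l.sz).val = l := by
  simp [removeAt]

theorem removeAt_node_node_val {rl rr : AVL β} {b : β} {k' s' : ℕ} :
    (removeAt (node l a (node rl b rr k' s') k s) l.sz).val =
      (bal l (popMin rl b rr).val.1 (popMin rl b rr).val.2).val := by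
  simp [removeAt]

theorem inorder_removeAt (h : t.WF) (i : ℕ) :
    (removeAt t i).val.inorder = t.inorder.eraseIdx i := by
  induction h generalizing i with
  | nil => simp [removeAt]
  | @node l r a hl _ _ _ ihl ihr =>
    have hlen := hl.length_inorder
    rcases lt_trichotomy i l.sz with hi | rfl | hi
    · rw [removeAt_node_val_of_lt hi, bal_inorder, ihl, inorder_node,
        List.eraseIdx_append_of_lt_length (by omega)]
    · rw [inorder_node, List.eraseIdx_append_of_length_le (by omega), hlen, Nat.sub_self,
        List.eraseIdx_cons_zero]
      cases r with
      | nil => rw [removeAt_node_nil_val, inorder_nil, List.append_nil]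
      | node => rw [removeAt_node_node_val, bal_inorder, cons_inorder_popMin, inorder_node]
    · obtain ⟨j, rfl⟩ : ∃ j, i = l.inorder.length + (j + 1) := ⟨i - l.sz - 1, by omega⟩
      have hj : l.inorder.length + (j + 1) - l.sz - 1 = j := by omega
      rw [removeAt_node_val_of_gt hi, bal_inorder, ihr, hj, inorder_node,
        List.eraseIdx_append_of_length_le (by omega), Nat.add_sub_cancel_left,
        List.eraseIdx_cons_succ]

theorem removeAt_wf (h : t.WF) (i : ℕ) : (removeAt t i).val.WF ∧
    (removeAt t i).val.ht ≤ t.ht ∧ t.ht ≤ (removeAt t i).val.ht + 1 := by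
  induction h generalizing i with
  | nil => exact ⟨.nil, Nat.zero_le _, Nat.zero_le _⟩
  | @node l r a hl hr hlr hrl ihl ihr =>
    rw [ht_node]
    rcases lt_trichotomy i l.sz with hi | rfl | hi
    · obtain ⟨hwf, _, _⟩ := ihl i
      obtain ⟨hwf', _, _, _⟩ := bal_wf (a := a) hwf hr (by omega) (by omega)
      rw [removeAt_node_val_of_lt hi]
      exact ⟨hwf', by omega, by omega⟩
    · cases r with
      | nil =>
        rw [removeAt_node_nil_val]
        rw [ht_nil] at *
        exact ⟨hl, by omega, by omega⟩
      | node rl b rr kr sr =>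
        obtain ⟨hwf, _, _⟩ := popMin_wf hr
        rw [ht_node] at *
        obtain ⟨hwf', _, _, _⟩ := bal_wf (a := (popMin rl b rr).val.1) hl hwf (by omega) (by omega)
        rw [removeAt_node_node_val]
        exact ⟨hwf', by omega, by omega⟩
    · obtain ⟨hwf, _, _⟩ := ihr (i - l.sz - 1)
      obtain ⟨hwf', _, _, _⟩ := bal_wf (a := a) hl hwf (by omega) (by omega)
      rw [removeAt_node_val_of_gt hi]
      exact ⟨hwf', by omega, by omega⟩

theorem sz_removeAt_add_one (h : t.WF) (hi : i < t.sz) : (removeAt t i).val.sz + 1 = t.sz := by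
  rw [← (removeAt_wf h i).1.length_inorder, inorder_removeAt h, ← h.length_inorder] at *
  exact List.length_eraseIdx_add_one hi

theorem removeAt_fits (h : t.WF) (hi : i < t.sz) :
    (removeAt t i).Fits (35 * (t.ht + 1)) (t.ht + 1) 0 (t.ht + 2) := by
  induction h generalizing i with
  | nil => exact absurd hi i.not_lt_zero
  | @node l r a _ hr _ _ ihl ihr =>
    refine call_fits ?_
    rw [ht_node]
    rw [sz_node] at hi
    simp only [lt_bind_ite, tick, subN, step_bind_fits_iff]
    split_ifs with hlt hgt
    · exact (ihl hlt).bind_of bal_fits (by omega) (by omega) (by omega) (by omega)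
    · simp only [step_bind_fits_iff]
      have hi' : i - l.sz - 1 < r.sz := by omega
      exact (ihr hi').bind_of bal_fits (by omega) (by omega) (by omega) (by omega)
    · simp only [step_bind_fits_iff]
      cases r with
      | nil =>
        exact (bind_pure_fits_iff _ _).2 (free_fits.mono (t := 1) (c := 0) (t' := 0) (by omega)
          (by omega) (by omega))
      | node =>
        rw [ht_node]
        exact (popMin_fits hr).bind_of bal_fits (by omega) (by omega) (by omega) (by omega)

theorem get?_val (h : t.WF) (i : ℕ) : (get? t i).val = t.inorder[i]? := by
  induction h generalizing i with
  | nil => simp [get?]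
  | @node l r a hl _ _ _ ihl ihr =>
    have hlen := hl.length_inorder
    rw [inorder_node]
    rcases lt_trichotomy i l.sz with hi | rfl | hi
    · simp [get?, hi, ihl, List.getElem?_append_left (hlen ▸ hi)]
    · simp [get?, ← hlen]
    · obtain ⟨j, rfl⟩ : ∃ j, i = l.inorder.length + (j + 1) := ⟨i - l.sz - 1, by omega⟩
      have hj : l.inorder.length + (j + 1) - l.sz - 1 = j := by omega
      simp [get?, hi, hi.not_gt, ihr, hj, List.getElem?_append_right]

theorem get?_fits (h : t.WF) (i : ℕ) : (get? t i).Fits (5 * (t.ht + 1)) 0 0 0 := by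
  induction h generalizing i with
  | nil => simp [get?]
  | node _ _ _ _ ihl ihr =>
    simp only [get?, lt_bind_ite, tick, subN, step_bind_fits_iff, ht_node]
    split_ifs
    · exact (ihl i).mono (by omega) le_rfl le_rfl
    · simp only [step_bind_fits_iff]
      exact (ihr _).mono (by omega) le_rfl le_rfl
    · simp; omega

theorem setAt_wf (h : t.WF) (i : ℕ) (x : β) : (setAt t i x).val.WF ∧
    (setAt t i x).val.ht = t.ht ∧ (setAt t i x).val.sz = t.sz := by
  induction h generalizing i with
  | nil => exact ⟨.nil, rfl, rfl⟩
  | @node l r a hl hr hlr hrl ihl ihr =>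
    rcases lt_trichotomy i l.sz with hi | rfl | hi
    · have hval : (setAt (node l a r (max l.ht r.ht + 1) (l.sz + r.sz + 1)) i x).val =
          node (setAt l i x).val a r (max l.ht r.ht + 1) (l.sz + r.sz + 1) := by
        simp [setAt, hi]
      obtain ⟨hwf, hht, hsz⟩ := ihl i
      rw [hval, ← hht, ← hsz]
      exact ⟨.node hwf hr (by omega) (by omega), rfl, rfl⟩
    · have hval : (setAt (node l a r (max l.ht r.ht + 1) (l.sz + r.sz + 1)) l.sz x).val =
          node l x r (max l.ht r.ht + 1) (l.sz + r.sz + 1) := by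
        simp [setAt]
      rw [hval]
      exact ⟨.node hl hr hlr hrl, rfl, rfl⟩
    · have hval : (setAt (node l a r (max l.ht r.ht + 1) (l.sz + r.sz + 1)) i x).val =
          node l a (setAt r (i - l.sz - 1) x).val (max l.ht r.ht + 1) (l.sz + r.sz + 1) := by
        simp [setAt, hi, hi.not_gt]
      obtain ⟨hwf, hht, hsz⟩ := ihr (i - l.sz - 1)
      rw [hval, ← hht, ← hsz]
      exact ⟨.node hl hwf (by omega) (by omega), rfl, rfl⟩

theorem inorder_setAt (h : t.WF) (i : ℕ) (x : β) :
    (setAt t i x).val.inorder = t.inorder.set i x := by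
  induction h generalizing i with
  | nil => simp [setAt]
  | @node l r a hl _ _ _ ihl ihr =>
    have hlen := hl.length_inorder
    rcases lt_trichotomy i l.sz with hi | rfl | hi
    · simp [setAt, hi, ihl, List.set_append_left, hlen]
    · simp [setAt, ← hlen]
    · obtain ⟨j, rfl⟩ : ∃ j, i = l.inorder.length + (j + 1) := ⟨i - l.sz - 1, by omega⟩
      have hj : l.inorder.length + (j + 1) - l.sz - 1 = j := by omega
      simp [setAt, hi, hi.not_gt, ihr, hj]

theorem setAt_fits (h : t.WF) (i : ℕ) (x : β) :
    (setAt t i x).Fits (7 * (t.ht + 1)) t.ht 0 t.ht := by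
  induction h generalizing i with
  | nil => simp [setAt]
  | @node l r a _ _ _ _ ihl ihr =>
    refine call_fits ?_
    have hstep (t : AVL β) : (step t).Fits 1 0 0 0 := (step_fits_iff t).2 ⟨le_rfl, le_rfl⟩
    simp only [lt_bind_ite, tick, subN, step_bind_fits_iff, ht_node]
    split_ifs
    · exact (ihl i).bind_of (hstep _) (by omega) (by omega) (by omega) (by omega)
    · simp only [step_bind_fits_iff]
      exact (ihr _).bind_of (hstep _) (by omega) (by omega) (by omega) (by omega)
    · simp only [step_bind_fits_iff, step_fits_iff]
      omega

section Search

variable {p : β → Bool}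

theorem search_val_le (h : t.WF) (acc : ℕ) :
    (search (fun a => step (p a)) t acc).val ≤ acc + t.sz := by
  induction h generalizing acc with
  | nil => simp [search]
  | @node l r a _ _ _ _ ihl ihr =>
    have hleft := ihl acc
    have hright := ihr (acc + l.sz + 1)
    rw [sz_node]
    cases ha : p a
    · simp only [search, tick, Run.step_bind_val, ha, Bool.false_eq_true, if_false]
      omega
    · simp only [search, tick, Run.step_bind_val, ha, if_true, addN]
      omega

theorem search_fits (h : t.WF) (acc : ℕ) :
    (search (fun a => step (p a)) t acc).Fits (4 * (t.ht + 1)) 0 0 0 := by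
  induction h generalizing acc with
  | nil => simp [search]
  | node _ _ _ _ ihl ihr =>
    simp only [search, tick, addN, step_bind_fits_iff, ht_node]
    split_ifs
    · simp only [step_bind_fits_iff]
      exact (ihr _).mono (by omega) le_rfl le_rfl
    · exact (ihl _).mono (by omega) le_rfl le_rfl

theorem search_val_eq_countP (h : t.WF) (hp : t.inorder.Pairwise fun a b => p b → p a) (acc : ℕ) :
    (search (fun a => step (p a)) t acc).val = acc + t.inorder.countP p := by
  induction h generalizing acc with
  | nil => simp [search]
  | @node l r a hl _ _ _ ihl ihr =>
    simp only [inorder_node, List.pairwise_append, List.pairwise_cons, List.mem_cons,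
      forall_eq_or_imp] at hp
    obtain ⟨hpl, ⟨har, hpr⟩, hlr⟩ := hp
    cases ha : p a
    · have hright : r.inorder.countP p = 0 :=
        List.countP_eq_zero.2 fun b hb hpb => by simp [har b hb hpb] at ha
      simp [search, ha, ihl hpl, hright]
    · have hleft : l.inorder.countP p = l.sz :=
        hl.length_inorder ▸ List.countP_eq_length.2 fun b hb => (hlr b hb).1 ha
      simp only [search, tick, addN, Run.step_bind_val, ha, if_true, ihr hpr, inorder_node,
        List.countP_append, List.countP_cons_of_pos, hleft]
      omega

end Search

theorem toList_val (t : AVL β) (acc : List β) : (toList t acc).val = t.inorder ++ acc := by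
  induction t generalizing acc with
  | nil => simp [toList]
  | node _ _ _ _ _ ihl ihr => simp [toList, ihl, ihr]

theorem toList_fits (h : t.WF) (acc : List β) :
    (toList t acc).Fits (5 * t.sz + 1) (t.sz + t.ht) 0 t.ht := by
  induction h generalizing acc with
  | nil => simp [toList]
  | @node l r a _ _ _ _ ihl ihr =>
    have hcall : l.sz + r.sz + 1 + (max l.ht r.ht + 1) =
        l.sz + r.sz + 1 + max l.ht r.ht + 1 := rfl
    rw [ht_node, sz_node, hcall]
    refine call_fits ?_
    have hright : (toList r acc).Fits (5 * (l.sz + r.sz + 1) + 1) (l.sz + r.sz + 1 + max l.ht r.ht)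
        (5 * l.sz + 5) (l.sz + 1 + max l.ht r.ht) :=
      (ihr acc).mono (by omega) (by omega) (by omega)
    have hleft (acc : List β) : (toList l acc).Fits (5 * l.sz + 3) (l.sz + max l.ht r.ht)
        2 (max l.ht r.ht) :=
      (ihl acc).mono (by omega) (by omega) (by omega)
    refine hright.bind (Run.Fits.bind ?_ (hleft _))
    exact (cons_fits a _ (c := l.sz + max l.ht r.ht)).mono le_rfl (by omega) (by omega)

end AVL

/-! ### The inverted index -/

section Index

variable {α : Type} [LinearOrder α] {P : List α} {L L₁ L₂ : List (α × Array ℕ)} {t : α}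
  {map : PosMap α}

/-- `L` lists distinct tokens of `P`, in ascending order, each with an array that is no longer than
its number of occurrences in `P`.  Which positions the arrays hold is irrelevant for the costs. -/
structure IsIndex (P : List α) (L : List (α × Array ℕ)) : Prop where
  sorted : L.Pairwise fun e e' => e.1 < e'.1
  mem : ∀ e ∈ L, e.1 ∈ P
  size_le : ∀ e ∈ L, e.2.size ≤ P.count e.1

theorem IsIndex.update (h : IsIndex P L) (hsub : (L₁ ++ L₂).Sublist L) (hL₁ : ∀ e ∈ L₁, e.1 < t)
    (hL₂ : ∀ e ∈ L₂, t < e.1) {A : Array ℕ} (hA : A.size ≤ P.count t + 1) :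
    IsIndex (P ++ [t]) (L₁ ++ (t, A) :: L₂) := by
  have hmem : ∀ e ∈ L₁ ++ (t, A) :: L₂, e = (t, A) ∨ e ∈ L := fun e he => by
    rcases List.mem_cons.1 (List.perm_middle.mem_iff.1 he) with rfl | he
    · exact .inl rfl
    · exact .inr (hsub.subset he)
  refine ⟨?_, fun e he => ?_, fun e he => ?_⟩
  · obtain ⟨hs₁, hs₂, hs⟩ := List.pairwise_append.1 (h.sorted.sublist hsub)
    refine List.pairwise_append.2 ⟨hs₁, List.pairwise_cons.2 ⟨hL₂, hs₂⟩, fun e he e' he' => ?_⟩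
    rcases List.mem_cons.1 he' with rfl | he'
    · exact hL₁ e he
    · exact hs e he e' he'
  · rcases hmem e he with rfl | he
    · exact List.mem_append_right P List.mem_cons_self
    · exact List.mem_append_left _ (h.mem e he)
  · rcases hmem e he with rfl | he
    · simpa using hA
    · exact (h.size_le e he).trans ((List.sublist_append_left P [t]).count_le _)

theorem exists_split_of_sorted (hL : L.Pairwise fun e e' => e.1 < e'.1) (t : α) :
    ∃ L₁ L₂, L = L₁ ++ L₂ ∧ (∀ e ∈ L₁, e.1 < t) ∧ ∀ e ∈ L₂, t ≤ e.1 := by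
  induction L with
  | nil => exact ⟨[], [], by simp⟩
  | cons e L ih =>
    rw [List.pairwise_cons] at hL
    by_cases he : e.1 < t
    · obtain ⟨L₁, L₂, rfl, hL₁, hL₂⟩ := ih hL.2
      exact ⟨e :: L₁, L₂, rfl, List.forall_mem_cons.2 ⟨he, hL₁⟩, hL₂⟩
    · exact ⟨[], e :: L, rfl, by simp, List.forall_mem_cons.2
        ⟨not_lt.1 he, fun e' he' => (not_lt.1 he).trans (hL.1 e' he').le⟩⟩

theorem addPosition_fits (hmap : map.WF) (t : α) (i : ℕ) :
    (addPosition map t i).Fits (45 * (map.ht + 1)) (map.ht + 2) 0 map.ht := by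
  have insert_fits (k : ℕ) : (append #[] i >>= fun A => AVL.insertAt map k (t, A)).Fits
      (31 * (map.ht + 1) + 2) (map.ht + 2) 0 map.ht :=
    (append_fits #[] i (t := 0) (c := 0)).bind_of (AVL.insertAt_fits hmap k _)
      (by omega) (by omega) (by omega) (by omega)
  refine (AVL.search_fits hmap 0).bind_of (u := 41 * (map.ht + 1)) (u' := 0)
    (d := map.ht + 2) (d' := map.ht) ?_ (by omega) (by omega) (by omega) (by omega)
  refine (AVL.get?_fits hmap _).bind_of (u := 36 * (map.ht + 1)) (u' := 0)
    (d := map.ht + 2) (d' := map.ht) ?_ (by omega) (by omega) (by omega) (by omega)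
  split
  · exact (insert_fits _).mono (by omega) le_rfl le_rfl
  · simp only [eq_bind_ite, tick, step_bind_fits_iff]
    split_ifs
    · exact (append_fits _ i (t := 0) (c := 0)).bind_of (AVL.setAt_fits hmap _ _)
        (by omega) (by omega) (by omega) (by omega)
    · exact (insert_fits _).mono (by omega) le_rfl le_rfl

section Value

variable (hmap : map.WF) (hL : map.inorder = L₁ ++ L₂) (hL₁ : ∀ e ∈ L₁, e.1 < t)
include hmap hL hL₁

theorem search_lt_val (hsorted : map.inorder.Pairwise fun e e' => e.1 < e'.1)
    (hL₂ : ∀ e ∈ L₂, t ≤ e.1) :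
    (AVL.search (fun e => lt e.1 t) map 0).val = L₁.length := by
  have hprefix : map.inorder.Pairwise fun e e' => decide (e'.1 < t) → decide (e.1 < t) :=
    hsorted.imp fun hlt hb => decide_eq_true (hlt.trans (of_decide_eq_true hb))
  refine (AVL.search_val_eq_countP hmap hprefix 0).trans ?_
  rw [hL, List.countP_append, List.countP_eq_length.2 fun e he => decide_eq_true (hL₁ e he),
    List.countP_eq_zero.2 fun e he => by simpa using hL₂ e he, zero_add, add_zero]

theorem addPosition_val_of_lt (hsorted : map.inorder.Pairwise fun e e' => e.1 < e'.1)
    (hL₂ : ∀ e ∈ L₂, t < e.1) (i : ℕ) :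
    (addPosition map t i).val = (AVL.insertAt map L₁.length (t, #[i])).val := by
  have hsearch := search_lt_val hmap hL hL₁ hsorted fun e he => (hL₂ e he).le
  have hget : (AVL.get? map L₁.length).val = L₂.head? := by
    rw [AVL.get?_val hmap, hL, List.getElem?_append_right le_rfl, Nat.sub_self,
      List.head?_eq_getElem?]
  cases L₂ with
  | nil => simp [addPosition, hsearch, hget]
  | cons e L₂ => simp [addPosition, hsearch, hget, (List.forall_mem_cons.1 hL₂).1.ne']

theorem addPosition_val_of_mem {A : Array ℕ} {L₃ : List (α × Array ℕ)} (hL₂ : L₂ = (t, A) :: L₃)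
    (hsorted : map.inorder.Pairwise fun e e' => e.1 < e'.1) (i : ℕ) :
    (addPosition map t i).val = (AVL.setAt map L₁.length (t, A.push i)).val := by
  subst hL₂
  have htail : ∀ e ∈ L₃, t < e.1 :=
    (List.pairwise_cons.1 (List.pairwise_append.1 (hL ▸ hsorted)).2.1).1
  have hsearch := search_lt_val hmap hL hL₁ hsorted
    (List.forall_mem_cons.2 ⟨le_rfl, fun e he => (htail e he).le⟩)
  have hget : (AVL.get? map L₁.length).val = some (t, A) := by simp [AVL.get?_val hmap, hL]
  simp [addPosition, hsearch, hget]

end Value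

theorem addPosition_spec (hmap : map.WF) (hindex : IsIndex P map.inorder) (t : α) (i : ℕ) :
    (addPosition map t i).val.WF ∧ (addPosition map t i).val.sz ≤ map.sz + 1 ∧
      IsIndex (P ++ [t]) (addPosition map t i).val.inorder := by
  obtain ⟨L₁, L₂, hL, hL₁, hL₂⟩ := exists_split_of_sorted hindex.sorted t
  have hsorted : (L₁ ++ L₂).Pairwise fun e e' => e.1 < e'.1 := hL ▸ hindex.sorted
  by_cases hhead : ∃ A L₃, L₂ = (t, A) :: L₃
  · obtain ⟨A, L₃, rfl⟩ := hhead
    have hsize : A.size ≤ P.count t := hindex.size_le (t, A) (by simp [hL])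
    obtain ⟨hwf, -, hsz⟩ := AVL.setAt_wf hmap L₁.length (t, A.push i)
    rw [addPosition_val_of_mem hmap hL hL₁ rfl hindex.sorted, AVL.inorder_setAt hmap, hL]
    refine ⟨hwf, hsz.trans_le (Nat.le_add_right _ _), ?_⟩
    rw [List.set_append_right _ _ le_rfl, Nat.sub_self, List.set_cons_zero]
    refine hindex.update (hL ▸ ?_) hL₁ ?_ (by simpa using hsize)
    · exact (List.pairwise_cons.1 (List.pairwise_append.1 hsorted).2.1).1
    · exact (List.sublist_cons_self _ L₃).append_left L₁
  · have hlt : ∀ e ∈ L₂, t < e.1 := by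
      cases L₂ with
      | nil => simp
      | cons e L₃ =>
        have he : t < e.1 := lt_of_le_of_ne (hL₂ e List.mem_cons_self)
          fun heq => hhead ⟨e.2, L₃, by rw [heq]⟩
        have htail := (List.pairwise_cons.1 (List.pairwise_append.1 hsorted).2.1).1
        exact List.forall_mem_cons.2 ⟨he, fun e' he' => he.trans (htail e' he')⟩
    rw [addPosition_val_of_lt hmap hL hL₁ hindex.sorted hlt, AVL.inorder_insertAt hmap,
      AVL.sz_insertAt hmap, hL, List.take_left, List.drop_left]
    exact ⟨(AVL.insertAt_wf hmap _ _).1, le_rfl,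
      hindex.update (hL ▸ List.Sublist.refl _) hL₁ hlt (by simp)⟩

/-- One round of the loop of `buildMap`: the token `t` at the position `s.2`. -/
def indexStep (t : α) (s : PosMap α × ℕ) : Run (PosMap α × ℕ) := do
  let map' ← addPosition s.1 t s.2
  let i' ← addN s.2 1
  return (map', i')

/-- The invariant of the loop of `buildMap` when the tokens `l` of `T` are still to come. -/
def IndexInv (T l : List α) (s : PosMap α × ℕ) : Prop :=
  ∃ P, T = P ++ l ∧ s.1.WF ∧ s.1.sz ≤ P.length ∧ IsIndex P s.1.inorder

theorem indexStep_spec {T l : List α} {s : PosMap α × ℕ} {ℓ : ℕ}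
    (hℓ : Nat.log 2 (T.length + 1) + 1 ≤ ℓ) (hs : IndexInv T (t :: l) s) :
    IndexInv T l (indexStep t s).val ∧
      (indexStep t s).Fits (92 * ℓ) (T.length + 2) 1 T.length := by
  obtain ⟨P, hT, hwf, hsz, hindex⟩ := hs
  obtain ⟨hwf', hsz', hindex'⟩ := addPosition_spec hwf hindex t s.2
  have hP : P.length < T.length := by simp [hT]
  have hht : s.1.ht ≤ 2 * Nat.log 2 (T.length + 1) + 1 := hwf.ht_le_log (by omega)
  have hht_sz : s.1.ht ≤ s.1.sz := hwf.ht_le_sz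
  refine ⟨⟨P ++ [t], by simp [hT], hwf', ?_, hindex'⟩, ?_⟩
  · rw [List.length_append, List.length_singleton]
    exact hsz'.trans (Nat.add_le_add_right hsz 1)
  · have htick : (addN s.2 1 >>= fun i' => pure ((addPosition s.1 t s.2).val, i')).Fits
        2 0 1 0 := by simp
    exact (addPosition_fits hwf t s.2).bind_of htick
      (by omega) (by omega) (by omega) (by omega)

theorem buildMap_spec {T : List α} {ℓ : ℕ} (hℓ : Nat.log 2 (T.length + 1) + 1 ≤ ℓ) :
    IsIndex T (buildMap T).val ∧
      (buildMap T).Fits (100 * ((T.length + 1) * ℓ)) (4 * T.length) 0 T.length := by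
  have hinit : IndexInv T T ((AVL.nil : PosMap α), 1) :=
    ⟨[], rfl, .nil, le_rfl, ⟨by simp, by simp, by simp⟩⟩
  obtain ⟨⟨P, hT, hwf, hsz, hindex⟩, hloop⟩ :=
    forList_fits (f := indexStep) (I := IndexInv T)
      (τ := fun l _ => l.length * (92 * ℓ)) (κ := fun l _ => 2 * l.length + T.length)
      (fun t l s hs => ⟨(indexStep_spec hℓ hs).1, (indexStep_spec hℓ hs).2.mono
        (by rw [List.length_cons, add_one_mul]; omega)
        (by rw [List.length_cons]; omega) (by rw [List.length_cons]; omega)⟩) hinit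
  rw [List.append_nil] at hT
  rw [← hT] at hsz hindex
  set s := (forList T ((AVL.nil : PosMap α), 1) indexStep).val
  have hval : (buildMap T).val = s.1.inorder :=
    (AVL.toList_val s.1 []).trans (List.append_nil _)
  have hht : s.1.ht ≤ s.1.sz := hwf.ht_le_sz
  refine ⟨hval ▸ hindex, ?_⟩
  have hsteps : T.length * (92 * ℓ) + (5 * T.length + 2) ≤ 100 * ((T.length + 1) * ℓ) := by
    nlinarith [Nat.mul_le_mul_left T.length (show 1 ≤ ℓ by omega)]
  simp only [List.length_nil, zero_mul, mul_zero, zero_add] at hloop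
  exact hloop.bind_of (AVL.toList_fits hwf []) (by omega) (by omega) (by omega) (by omega)

end Index

/-! ### Generating the keys -/

section Generation

variable {α : Type} (h : α → ℕ → ℕ) (t : α)

theorem forRange_cons_spec {β : Type} {f : ℕ → List β → Run (List β)} {k : ℕ}
    (hlen : ∀ i K, (f i K).val.length = K.length + 1) (hfits : ∀ i K, (f i K).Fits k 1 1 0)
    (lo cnt : ℕ) (K : List β) :
    (forRange lo cnt K f).val.length = K.length + cnt ∧
      (forRange lo cnt K f).Fits (cnt * k + 1) cnt 0 0 := by
  obtain ⟨hval, hfits⟩ := forRange_fits (f := f) (I := fun i s => s.length + lo = K.length + i)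
    (τ := fun j _ => j * k) (κ := fun j _ => j)
    (fun i j s _ hs => ⟨by rw [hlen]; omega,
      (hfits i s).mono (by rw [add_one_mul]; omega) (by omega) (by omega)⟩)
    (lo := lo) (cnt := cnt) (s := K) rfl
  exact ⟨by omega, by simpa only [zero_mul] using hfits⟩

open Classical in
/-- The number of active keys with `x` occurrences of a token `t` that occurs `m` times. -/
noncomputable def activeWeight (m x : ℕ) : ℕ := if IsActiveHash h t x then m + 1 - x else 0

/-- The number of active keys of a token `t` that occurs `m` times. -/
noncomputable def activeCount (m : ℕ) : ℕ := ∑ x ∈ Finset.Ico 1 (m + 1), activeWeight h t m x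

theorem activeCount_mono : Monotone (activeCount h t) := fun m m' hm => by
  have hweight (x : ℕ) : activeWeight h t m x ≤ activeWeight h t m' x := by
    unfold activeWeight
    split_ifs <;> omega
  exact (Finset.sum_le_sum fun x _ => hweight x).trans
    (Finset.sum_le_sum_of_subset (Finset.Ico_subset_Ico_right (by omega)))

/-- One round of the loop of `generateActiveKeys` over the number `x` of occurrences of `t`; the
state `s` holds the keys listed so far and the smallest hash value seen so far. -/
def activeStep (A : Array ℕ) (x : ℕ) (s : List HKey × WithTop ℕ) :
    Run (List HKey × WithTop ℕ) := do
  let v ← hash h t x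
  if ← lt (v : WithTop ℕ) s.2 then
    let m ← addN A.size 1
    let cnt ← subN m x
    let K' ← forRange 0 cnt s.1 fun i K => do
      let u ← addN i x
      let e ← subN u 1
      let p ← read A i
      let q ← read A e
      cons ⟨p, q, v⟩ K
    return (K', (v : WithTop ℕ))
  else
    return s

variable {h t}

theorem activeStep_spec (A : Array ℕ) {x : ℕ} {s : List HKey × WithTop ℕ}
    (hs : ∀ x', 1 ≤ x' → x' < x → s.2 ≤ h t x') :
    (∀ x', 1 ≤ x' → x' < x + 1 → (activeStep h t A x s).val.2 ≤ h t x') ∧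
      (activeStep h t A x s).val.1.length ≤ s.1.length + activeWeight h t A.size x ∧
      (activeStep h t A x s).Fits (7 * activeWeight h t A.size x + 6)
        (activeWeight h t A.size x) 1 0 := by
  by_cases hv : (h t x : WithTop ℕ) < s.2
  · have hactive : IsActiveHash h t x := fun x' h₁ h₂ => by
      exact_mod_cast hv.trans_le (hs x' h₁ h₂)
    rw [activeWeight, if_pos hactive]
    obtain ⟨hlen, hfits⟩ := forRange_cons_spec (k := 7)
      (f := fun i K => do
        let u ← addN i x
        let e ← subN u 1
        let p ← read A i
        let q ← read A e
        cons ⟨p, q, h t x⟩ K)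
      (fun i K => by simp) (fun i K => by simpa using cons_fits _ _) 0 (A.size + 1 - x) s.1
    simp only [activeStep, hash, lt_bind_ite, tick, addN, subN, Run.step_bind_val,
      step_bind_fits_iff, if_pos hv]
    refine ⟨fun x' h₁ h₂ => ?_, hlen.le, ?_⟩
    · rcases Nat.lt_succ_iff_lt_or_eq.1 h₂ with h₂ | rfl
      · exact WithTop.coe_le_coe.2 (hactive x' h₁ h₂).le
      · exact le_rfl
    · exact (bind_pure_fits_iff _ _).2 (hfits.mono (by omega) le_rfl (by omega))
  · simp only [activeStep, hash, lt_bind_ite, tick, Run.step_bind_val, step_bind_fits_iff,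
      if_neg hv, Run.pure_val, pure_fits_iff]
    refine ⟨fun x' h₁ h₂ => ?_, Nat.le_add_right _ _, by omega, by omega⟩
    rcases Nat.lt_succ_iff_lt_or_eq.1 h₂ with h₂ | rfl
    · exact hs x' h₁ h₂
    · exact not_lt.1 hv

/-- The procedure `f` lists, for a token `t` with an array of `m` positions, at most `g t m` keys,
in time linear in `m` and `g t m`. -/
structure ListsKeys (f : α × Array ℕ → List HKey → Run (List HKey)) (g : α → ℕ → ℕ) : Prop where
  length_le : ∀ e K, (f e K).val.length ≤ K.length + g e.1 e.2.size
  fits : ∀ e K, (f e K).Fits (6 * e.2.size + 8 * g e.1 e.2.size + 1) (g e.1 e.2.size) 0 0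

/-- The body of the outer loop of `generateActiveKeys`. -/
def listActive (h : α → ℕ → ℕ) (e : α × Array ℕ) (K : List HKey) : Run (List HKey) := do
  let s ← forRange 1 e.2.size (K, (⊤ : WithTop ℕ)) (activeStep h e.1 e.2)
  return s.1

theorem listsKeys_listActive : ListsKeys (listActive h) (activeCount h) := by
  suffices hloop : ∀ t (A : Array ℕ) (K : List HKey),
      (listActive h (t, A) K).val.length ≤ K.length + activeCount h t A.size ∧
        (listActive h (t, A) K).Fits (6 * A.size + 7 * activeCount h t A.size + 1)
          (activeCount h t A.size) 0 0 from
    ⟨fun e K => (hloop e.1 e.2 K).1,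
      fun e K => (hloop e.1 e.2 K).2.mono (by omega) le_rfl (by omega)⟩
  intro t A K
  let rest (k : ℕ) : ℕ := ∑ x ∈ Finset.Ico (A.size + 1 - k) (A.size + 1), activeWeight h t A.size x
  have hrest : rest A.size = activeCount h t A.size := by
    simp only [rest, Nat.add_sub_cancel_left, activeCount]
  have hrest_succ {x k : ℕ} (hx : x + (k + 1) = 1 + A.size) :
      rest (k + 1) = activeWeight h t A.size x + rest k := by
    simp only [rest]
    rw [show A.size + 1 - (k + 1) = x by omega, show A.size + 1 - k = x + 1 by omega,
      Finset.sum_eq_sum_Ico_succ_bot (by omega)]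
  obtain ⟨hval, hfits⟩ := forRange_fits (f := activeStep h t A) (lo := 1) (cnt := A.size)
    (I := fun x s => (∀ x', 1 ≤ x' → x' < x → s.2 ≤ h t x') ∧
      s.1.length + rest (A.size + 1 - x) ≤ K.length + activeCount h t A.size)
    (τ := fun k _ => 6 * k + 7 * rest k) (κ := fun k _ => rest k)
    (fun x k s hx hs => by
      obtain ⟨hmin, hlen, hfits⟩ := activeStep_spec A hs.1
      obtain ⟨-, hlen_le⟩ := hs
      rw [show A.size + 1 - x = k + 1 by omega] at hlen_le
      refine ⟨⟨hmin, ?_⟩, hfits.mono ?_ ?_ ?_⟩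
      · rw [show A.size + 1 - (x + 1) = k by omega]
        have := hrest_succ hx
        omega
      all_goals
        have := hrest_succ hx
        omega)
    (s := (K, (⊤ : WithTop ℕ))) ⟨fun x' _ _ => by omega, by simp [hrest]⟩
  rw [hrest] at hfits
  exact ⟨(Nat.le_add_right _ _).trans hval.2,
    (bind_pure_fits_iff _ _).2 (hfits.mono (by omega) le_rfl (by omega))⟩

/-- The body of the loop of `generateKeys` over the index `i` of the first position of a key. -/
def listFrom (h : α → ℕ → ℕ) (t : α) (A : Array ℕ) (i : ℕ) (K : List HKey) : Run (List HKey) := do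
  let cnt ← subN A.size i
  forRange i cnt K fun j K => do
    let p ← read A i
    let q ← read A j
    let m ← subN j i
    let x ← addN m 1
    let v ← hash h t x
    cons ⟨p, q, v⟩ K

theorem listFrom_spec (t : α) (A : Array ℕ) (i : ℕ) (K : List HKey) :
    (listFrom h t A i K).val.length = K.length + (A.size - i) ∧
      (listFrom h t A i K).Fits ((A.size - i) * 8 + 2) (A.size - i) 0 0 := by
  obtain ⟨hlen, hfits⟩ := forRange_cons_spec (k := 8)
    (f := fun j K => do
      let p ← read A i
      let q ← read A j
      let m ← subN j i
      let x ← addN m 1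
      let v ← hash h t x
      cons ⟨p, q, v⟩ K)
    (fun j K => by simp) (fun j K => by simpa using cons_fits _ _) i (A.size - i) K
  exact ⟨hlen, (step_bind_fits_iff _ _).2 (hfits.add_steps 1)⟩

/-- The body of the outer loop of `generateKeys`. -/
def listAll (h : α → ℕ → ℕ) (e : α × Array ℕ) (K : List HKey) : Run (List HKey) :=
  forRange 0 e.2.size K (listFrom h e.1 e.2)

theorem listsKeys_listAll : ListsKeys (listAll h) fun _ m => m * m := by
  suffices hloop : ∀ t (A : Array ℕ) (K : List HKey),
      (listAll h (t, A) K).val.length ≤ K.length + A.size * A.size ∧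
        (listAll h (t, A) K).Fits (A.size * (8 * A.size + 3) + 1) (A.size * A.size) 0 0 from
    ⟨fun e K => (hloop e.1 e.2 K).1,
      fun e K => (hloop e.1 e.2 K).2.mono (by nlinarith) le_rfl (by omega)⟩
  intro t A K
  obtain ⟨hlen, hfits⟩ := forRange_fits (f := listFrom h t A) (lo := 0) (cnt := A.size)
    (I := fun i s => s.length ≤ K.length + i * A.size)
    (τ := fun k _ => k * (8 * A.size + 3)) (κ := fun k _ => k * A.size)
    (fun i k s _ hs => by
      obtain ⟨hlen, hfits⟩ := listFrom_spec (h := h) t A i s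
      simp only [add_one_mul]
      exact ⟨hlen.trans_le (by omega), hfits.mono (by omega) (by omega) (by omega)⟩)
    (s := K) (by simp)
  rw [zero_add] at hlen
  exact ⟨hlen, hfits.mono (by omega) le_rfl (by omega)⟩

end Generation

section Entries

variable {α : Type} {f : α × Array ℕ → List HKey → Run (List HKey)} {g : α → ℕ → ℕ}
  {T : List α} {E : List (α × Array ℕ)} {h : α → ℕ → ℕ}

theorem ListsKeys.forList_spec (hf : ListsKeys f g) (E : List (α × Array ℕ)) :
    (forList E [] f).val.length ≤ (E.map fun e => g e.1 e.2.size).sum ∧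
      (forList E [] f).Fits ((E.map fun e => 6 * e.2.size + 8 * g e.1 e.2.size + 2).sum + 1)
        (E.map fun e => g e.1 e.2.size).sum 0 0 := by
  obtain ⟨hlen, hfits⟩ := forList_fits (f := f) (l := E) (s := [])
    (I := fun l K => K.length + (l.map fun e => g e.1 e.2.size).sum ≤
      (E.map fun e => g e.1 e.2.size).sum)
    (τ := fun l _ => (l.map fun e => 6 * e.2.size + 8 * g e.1 e.2.size + 2).sum)
    (κ := fun l _ => (l.map fun e => g e.1 e.2.size).sum)
    (fun e l K hK => by
      have hlen := hf.length_le e K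
      simp only [List.map_cons, List.sum_cons] at hK ⊢
      exact ⟨by omega, (hf.fits e K).mono (by omega) (by omega) (by omega)⟩)
    (by simp)
  exact ⟨by simpa using hlen, hfits⟩

variable [LinearOrder α]

theorem IsIndex.sum_le (hE : IsIndex T E) (hg : ∀ t, Monotone (g t)) :
    (E.map fun e => g e.1 e.2.size).sum ≤ ∑ t ∈ T.toFinset, g t (T.count t) := by
  have hnodup : (E.map Prod.fst).Nodup :=
    List.pairwise_map.2 (hE.sorted.imp fun hlt => hlt.ne)
  have hsubset : (E.map Prod.fst).toFinset ⊆ T.toFinset := fun t ht => by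
    obtain ⟨e, he, rfl⟩ := List.mem_map.1 (List.mem_toFinset.1 ht)
    exact List.mem_toFinset.2 (hE.mem e he)
  calc (E.map fun e => g e.1 e.2.size).sum
      ≤ (E.map fun e => g e.1 (T.count e.1)).sum :=
        List.sum_le_sum fun e he => hg _ (hE.size_le e he)
    _ = ((E.map Prod.fst).map fun t => g t (T.count t)).sum := by rw [List.map_map]; rfl
    _ = ∑ t ∈ (E.map Prod.fst).toFinset, g t (T.count t) := (List.sum_toFinset _ hnodup).symm
    _ ≤ ∑ t ∈ T.toFinset, g t (T.count t) := Finset.sum_le_sum_of_subset hsubset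

theorem ListsKeys.generate_spec (hf : ListsKeys f g) (hg : ∀ t, Monotone (g t)) {N ℓ : ℕ}
    (hN : ∑ t ∈ T.toFinset, g t (T.count t) ≤ N) (hℓ : Nat.log 2 (T.length + 1) + 1 ≤ ℓ) :
    (buildMap T >>= fun E => forList E [] f).val.length ≤ N ∧
      (buildMap T >>= fun E => forList E [] f).Fits
        (100 * ((T.length + 1) * ℓ) + (8 * T.length + 8 * N + 1)) (4 * T.length + N)
        0 T.length := by
  obtain ⟨hindex, hbuild⟩ := buildMap_spec hℓ
  obtain ⟨hlen, hlist⟩ := hf.forList_spec (buildMap T).val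
  have hkeys := (hindex.sum_le hg).trans hN
  have hsteps :
      ((buildMap T).val.map fun e => 6 * e.2.size + 8 * g e.1 e.2.size + 2).sum ≤
        8 * T.length + 8 * N := by
    refine (hindex.sum_le (g := fun t m => 6 * m + 8 * g t m + 2) fun t m m' hm => ?_).trans ?_
    · have := hg t hm
      dsimp only
      omega
    · have hdistinct : T.toFinset.card ≤ T.length := T.toFinset_card_le
      rw [Finset.sum_add_distrib, Finset.sum_add_distrib, ← Finset.mul_sum, ← Finset.mul_sum,
        List.sum_toFinset_count_eq_length, Finset.sum_const, smul_eq_mul]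
      omega
  exact ⟨hlen.trans hkeys, hbuild.bind_of hlist
    (by omega) (by omega) (by omega) (by omega)⟩

theorem generateActiveKeys_spec {N ℓ : ℕ} (hN : ∑ t ∈ T.toFinset, activeCount h t (T.count t) ≤ N)
    (hℓ : Nat.log 2 (T.length + 1) + 1 ≤ ℓ) :
    (generateActiveKeys T h).val.length ≤ N ∧ (generateActiveKeys T h).Fits
      (100 * ((T.length + 1) * ℓ) + (8 * T.length + 8 * N + 1)) (4 * T.length + N) 0 T.length :=
  listsKeys_listActive.generate_spec (activeCount_mono h) hN hℓ

theorem generateKeys_spec {N ℓ : ℕ} (hN : ∑ t ∈ T.toFinset, T.count t * T.count t ≤ N)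
    (hℓ : Nat.log 2 (T.length + 1) + 1 ≤ ℓ) :
    (generateKeys T h).val.length ≤ N ∧ (generateKeys T h).Fits
      (100 * ((T.length + 1) * ℓ) + (8 * T.length + 8 * N + 1)) (4 * T.length + N) 0 T.length :=
  listsKeys_listAll.generate_spec (fun _ _ _ hm => Nat.mul_le_mul hm hm) hN hℓ

end Entries

/-! ### Sorting the keys -/

theorem sortKeys_spec {K : List HKey} {ℓ : ℕ} (hℓ : Nat.log 2 (K.length + 1) + 1 ≤ ℓ) :
    (sortKeys K).val.length = K.length ∧
      (sortKeys K).Fits (K.length * (76 * ℓ) + 2) (3 * K.length) 0 K.length := by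
  obtain ⟨⟨hwf, hsz⟩, hfits⟩ := forList_fits (l := K) (s := (AVL.nil : AVL HKey))
    (f := fun s t => do
      let k ← AVL.search (fun s' => le s'.v s.v) t 0
      AVL.insertAt t k s)
    (I := fun l t => t.WF ∧ t.sz + l.length = K.length)
    (τ := fun l _ => l.length * (71 * ℓ)) (κ := fun l _ => l.length + K.length)
    (fun s l t ⟨hwf, hsz⟩ => by
      rw [List.length_cons] at hsz ⊢
      have hht : t.ht ≤ 2 * Nat.log 2 (K.length + 1) + 1 := hwf.ht_le_log (by omega)
      have hht_sz : t.ht ≤ t.sz := hwf.ht_le_sz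
      refine ⟨⟨(AVL.insertAt_wf hwf _ s).1, ?_⟩, ?_⟩
      · have := AVL.sz_insertAt hwf (AVL.search (fun s' => le s'.v s.v) t 0).val s
        exact (congrArg (· + l.length) this).trans (by omega)
      · rw [add_one_mul]
        exact (AVL.search_fits hwf 0).bind_of (AVL.insertAt_fits hwf _ s)
          (by omega) (by omega) (by omega) (by omega))
    ⟨.nil, zero_add _⟩
  have hht_sz := hwf.ht_le_sz
  simp only [List.length_nil, zero_mul, zero_add, add_zero] at hsz hfits
  refine ⟨?_, ?_⟩
  · exact (congrArg List.length (AVL.toList_val _ [])).trans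
      (by rw [List.append_nil, hwf.length_inorder, hsz])
  · have hsteps : K.length * (71 * ℓ) + 5 * K.length ≤ K.length * (76 * ℓ) := by
      nlinarith [Nat.mul_le_mul_left K.length (show 1 ≤ ℓ by omega)]
    exact hfits.bind_of (AVL.toList_fits hwf []) (by omega) (by omega) (by omega) (by omega)

/-! ### The main loop -/

theorem dominates_fits (s s' : ℕ × ℕ) : (dominates s s').Fits 4 0 0 0 := by
  simp only [dominates, le_bind_ite, eq_bind_ite, tick, step_bind_fits_iff]
  split_ifs <;> simp

/-- One round of the loop of `visit` that outputs windows; the state `s` holds the windows so far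
and the current value of `c'`. -/
def emitStep (key : HKey) (S : AVL (ℕ × ℕ)) (k : ℕ) (s : List Window × ℕ) :
    Run (List Window × ℕ) := do
  let sk ← AVL.get? S k
  let k' ← addN k 1
  let sk' ← AVL.get? S k'
  let a ← addN (sk.getD (0, 0)).1 1
  let d ← subN (sk'.getD (0, 0)).2 1
  if ← le a key.p then
    if ← le s.2 d then
      let P' ← cons ⟨key.v, a, key.p, s.2, d⟩ s.1
      return (P', (sk'.getD (0, 0)).2)
    else
      return (s.1, (sk'.getD (0, 0)).2)
  else
    return (s.1, (sk'.getD (0, 0)).2)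

/-- The part of `visit` for a key that is not dominated. -/
def insertKey (key : HKey) (S : AVL (ℕ × ℕ)) (P : List Window) :
    Run (AVL (ℕ × ℕ) × List Window) := do
  let cnt ← AVL.search (fun s => lt s.2 key.q) S 0
  let i ← subN cnt 1
  let j ← AVL.search (fun s => le s.1 key.p) S 0
  let len ← subN j i
  let s ← forRange i len (P, key.q) (emitStep key S)
  let i' ← addN i 1
  let rem ← subN j i'
  let S' ← forRange i' rem S fun _ S => AVL.removeAt S i'
  let S'' ← AVL.insertAt S' i' (key.p, key.q)
  return (S'', s.1)

theorem visit_eq (key : HKey) (S : AVL (ℕ × ℕ)) (P : List Window) :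
    visit key S P = (do
      let cnt' ← AVL.search (fun s => le s.2 key.q) S 0
      let j' ← subN cnt' 1
      let sj ← AVL.get? S j'
      if ← dominates (sj.getD (0, 0)) (key.p, key.q) then return (S, P)
      else insertKey key S P) := rfl

section Skyline

variable {S : AVL (ℕ × ℕ)} (hS : S.WF) (key : HKey) {ℓ : ℕ}
include hS

theorem emitStep_fits (k : ℕ) (s : List Window × ℕ) :
    (emitStep key S k s).Fits (10 * (S.ht + 1) + 7) 1 0 0 := by
  refine (AVL.get?_fits hS _).bind_of (u := 5 * (S.ht + 1) + 7) (d := 1) (u' := 0) (d' := 0) ?_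
    (by omega) (by omega) (by omega) (by omega)
  refine (step_bind_fits_iff _ _).2 ?_
  refine (AVL.get?_fits hS _).bind_of (u := 6) (d := 1) (u' := 0) (d' := 0) ?_
    (by omega) (by omega) (by omega) (by omega)
  simp only [le_bind_ite, tick, addN, subN, step_bind_fits_iff]
  split_ifs
  · exact (step_bind_fits_iff _ _).2 ((bind_pure_fits_iff _ _).2 (cons_fits _ _))
  · simp
  · simp

theorem emit_fits (i len : ℕ) (P : List Window) :
    (forRange i len (P, key.q) (emitStep key S)).Fits
      (len * (10 * (S.ht + 1) + 8) + 1) len 0 0 := by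
  have hfits := (forRange_fits (f := emitStep key S) (lo := i) (cnt := len) (s := (P, key.q))
    (I := fun _ _ => True) (τ := fun k _ => k * (10 * (S.ht + 1) + 8)) (κ := fun k _ => k)
    (fun k j s _ _ => ⟨trivial, (emitStep_fits hS key k s).mono
      (by rw [add_one_mul]; omega) (by omega) (by omega)⟩) trivial).2
  simpa only [zero_mul] using hfits

theorem forRange_removeAt_spec (hℓ : Nat.log 2 (S.sz + 1) + 1 ≤ ℓ) {i rem : ℕ}
    (hi : 0 < rem → i + rem ≤ S.sz) (lo : ℕ) :
    (forRange lo rem S fun _ S => AVL.removeAt S i).val.WF ∧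
      (forRange lo rem S fun _ S => AVL.removeAt S i).val.sz + rem = S.sz ∧
      (forRange lo rem S fun _ S => AVL.removeAt S i).Fits
        (rem * (71 * ℓ) + 1) (S.sz + 1) 0 (S.sz + 1 + rem) := by
  obtain ⟨⟨-, hwf, hsz⟩, hfits⟩ := forRange_fits (f := fun _ S => AVL.removeAt S i) (cnt := rem)
    (I := fun k S' => lo ≤ k ∧ S'.WF ∧ S'.sz + k = S.sz + lo)
    (τ := fun k _ => k * (71 * ℓ)) (κ := fun k _ => S.sz + 1 + (rem - k))
    (fun k m S' hk ⟨_, hwf, _⟩ => by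
      have hht : S'.ht ≤ 2 * Nat.log 2 (S.sz + 1) + 1 := hwf.ht_le_log (by omega)
      have hht_sz : S'.ht ≤ S'.sz := hwf.ht_le_sz
      have hlt : i < S'.sz := by omega
      have hsz' := AVL.sz_removeAt_add_one hwf hlt
      refine ⟨⟨by omega, (AVL.removeAt_wf hwf i).1, by omega⟩,
        (AVL.removeAt_fits hwf hlt).mono ?_ ?_ ?_⟩
      · rw [add_one_mul]
        omega
      all_goals omega)
    (lo := lo) ⟨le_rfl, hS, rfl⟩
  exact ⟨hwf, by omega, hfits.mono (by omega) (by omega) (by omega)⟩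

theorem insertKey_spec (hℓ : Nat.log 2 (S.sz + 1) + 1 ≤ ℓ) (P : List Window) :
    (insertKey key S P).val.1.WF ∧ (insertKey key S P).val.1.sz ≤ S.sz + 1 ∧
      (insertKey key S P).Fits (S.sz * (100 * ℓ) + 300 * ℓ) (2 * S.sz + 4)
        ((insertKey key S P).val.1.sz * (100 * ℓ)) (2 * S.sz + 2) := by
  set i := (AVL.search (fun s => lt s.2 key.q) S 0).val - 1
  set j := (AVL.search (fun s => le s.1 key.p) S 0).val
  set rem := j - (i + 1)
  have hj : j ≤ S.sz := (AVL.search_val_le hS 0).trans_eq (zero_add _)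
  obtain ⟨hwf, hsz, hremove⟩ := forRange_removeAt_spec hS hℓ (i := i + 1) (rem := rem)
    (by omega) (i + 1)
  set S' := (forRange (i + 1) rem S fun _ S => AVL.removeAt S (i + 1)).val
  have hval : (insertKey key S P).val.1 = (AVL.insertAt S' (i + 1) (key.p, key.q)).val := rfl
  have hsz' : (insertKey key S P).val.1.sz = S'.sz + 1 :=
    (congrArg AVL.sz hval).trans (AVL.sz_insertAt hwf _ _)
  have hht : S.ht ≤ 2 * Nat.log 2 (S.sz + 1) + 1 := hS.ht_le_log le_rfl
  have hht' : S'.ht ≤ 2 * Nat.log 2 (S.sz + 1) + 1 := hwf.ht_le_log (by omega)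
  have hht_sz : S'.ht ≤ S'.sz := hwf.ht_le_sz
  have hemit : (j - i) * (10 * (S.ht + 1) + 8) ≤ rem * (28 * ℓ) + 28 * ℓ :=
    (Nat.mul_le_mul (by omega) (by omega)).trans_eq (add_one_mul rem (28 * ℓ))
  have hsteps : rem * (28 * ℓ) + rem * (71 * ℓ) + 100 * ℓ + S'.sz * (100 * ℓ) ≤
      S.sz * (100 * ℓ) + 100 * ℓ := by
    rw [← hsz]
    nlinarith
  refine ⟨hval ▸ (AVL.insertAt_wf hwf _ _).1, by omega, ?_⟩
  rw [hsz', add_one_mul]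
  refine (AVL.search_fits hS 0).bind_of
    (u := rem * (28 * ℓ) + rem * (71 * ℓ) + 110 * ℓ + 4) (d := S.sz + 3 + rem)
    (u' := 0) (d' := S.sz + 1 + rem) ?_ (by omega) (by omega) (by omega) (by omega)
  refine (step_bind_fits_iff _ _).2 <| (AVL.search_fits hS 0).bind_of
    (u := rem * (28 * ℓ) + rem * (71 * ℓ) + 100 * ℓ + 3) (d := S.sz + 3 + rem)
    (u' := 0) (d' := S.sz + 1 + rem) ?_ (by omega) (by omega) (by omega) (by omega)
  refine (step_bind_fits_iff _ _).2 <| (emit_fits hS key i (j - i) P).bind_of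
    (u := rem * (71 * ℓ) + 62 * ℓ + 3) (d := S.sz + 2)
    (u' := 0) (d' := S.sz + 1 + rem) ?_ (by omega) (by omega) (by omega) (by omega)
  refine (step_bind_fits_iff _ _).2 <| (step_bind_fits_iff _ _).2 <| hremove.bind_of
    (u := 31 * (S'.ht + 1)) (d := S'.ht + 1)
    (u' := 0) (d' := S'.ht) ?_ (by omega) (by omega) (by omega) (by omega)
  exact (bind_pure_fits_iff _ _).2 (AVL.insertAt_fits hwf _ _)

theorem visit_spec (hℓ : Nat.log 2 (S.sz + 1) + 1 ≤ ℓ) (P : List Window) :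
    (visit key S P).val.1.WF ∧ (visit key S P).val.1.sz ≤ S.sz + 1 ∧
      (visit key S P).Fits (S.sz * (100 * ℓ) + 400 * ℓ) (2 * S.sz + 4)
        ((visit key S P).val.1.sz * (100 * ℓ)) (2 * S.sz + 2) := by
  have hht : S.ht ≤ 2 * Nat.log 2 (S.sz + 1) + 1 := hS.ht_le_log le_rfl
  set cnt := (AVL.search (fun s => le s.2 key.q) S 0).val
  set b := dominates (((AVL.get? S (cnt - 1)).val).getD (0, 0)) (key.p, key.q)
  have hval : (visit key S P).val = if b.val then (S, P) else (insertKey key S P).val := by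
    rw [visit_eq]
    exact apply_ite Run.val (b.val = true) (pure (S, P)) (insertKey key S P)
  obtain ⟨hwf, hsz, hins⟩ := insertKey_spec hS key hℓ P
  have hrest : (if b.val then pure (S, P) else insertKey key S P : Run _).Fits
      (S.sz * (100 * ℓ) + 300 * ℓ) (2 * S.sz + 4)
      ((visit key S P).val.1.sz * (100 * ℓ)) (2 * S.sz + 2) := by
    rw [hval]
    split_ifs
    · simp
    · exact hins
  refine ⟨?_, ?_, ?_⟩
  · rw [hval]
    split_ifs
    exacts [hS, hwf]
  · rw [hval]
    split_ifs
    exacts [Nat.le_succ _, hsz]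
  · refine (AVL.search_fits hS 0).bind_of (u := S.sz * (100 * ℓ) + 380 * ℓ) (d := 2 * S.sz + 4)
      (u' := (visit key S P).val.1.sz * (100 * ℓ)) (d' := 2 * S.sz + 2) ?_
      (by omega) (by omega) (by omega) (by omega)
    refine (step_bind_fits_iff _ _).2 <| (AVL.get?_fits hS _).bind_of
      (u := S.sz * (100 * ℓ) + 300 * ℓ + 4) (d := 2 * S.sz + 4)
      (u' := (visit key S P).val.1.sz * (100 * ℓ)) (d' := 2 * S.sz + 2) ?_
      (by omega) (by omega) (by omega) (by omega)
    exact (dominates_fits _ _).bind_of hrest (by omega) (by omega) (by omega) (by omega)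

end Skyline

theorem mainLoop_fits {S : AVL (ℕ × ℕ)} (hS : S.WF) (order : List HKey) (P : List Window) {ℓ : ℕ}
    (hℓ : Nat.log 2 (S.sz + order.length + 1) + 1 ≤ ℓ) :
    (forList order (S, P) fun key (S, P) => visit key S P).Fits
      (S.sz * (100 * ℓ) + order.length * (400 * ℓ + 1) + 1)
      (2 * S.sz + 4 * order.length + 2) 0 0 := by
  have hfits := (forList_fits (l := order) (s := (S, P)) (f := fun key s => visit key s.1 s.2)
    (I := fun l s => s.1.WF ∧ s.1.sz + l.length ≤ S.sz + order.length)
    (τ := fun l s => s.1.sz * (100 * ℓ) + l.length * (400 * ℓ + 1))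
    (κ := fun l _ => 2 * l.length + 2 * (S.sz + order.length) + 2)
    (fun key l s ⟨hwf, hsz⟩ => by
      rw [List.length_cons] at hsz ⊢
      have hlog : Nat.log 2 (s.1.sz + 1) ≤ Nat.log 2 (S.sz + order.length + 1) :=
        Nat.log_mono_right (by omega)
      obtain ⟨hwf', hsz', hvisit⟩ := visit_spec hwf key (ℓ := ℓ) (by omega) s.2
      refine ⟨⟨hwf', by omega⟩, hvisit.mono ?_ (by omega) (by omega)⟩
      rw [add_one_mul]
      omega)
    ⟨hS, le_rfl⟩).2
  exact hfits.mono (by simp only []; omega) (by omega) (by omega)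

/-- Steps 2 and 3 of monotonic partitioning: the windows of the keys `K` of a text of length `n`. -/
def partitionKeys (n : ℕ) (K : List HKey) : Run (List Window) := do
  let n1 ← addN n 1
  let S₀ ← AVL.insertAt AVL.nil 0 ((0, 0) : ℕ × ℕ)
  let S₁ ← AVL.insertAt S₀ 1 (n1, n1)
  let order ← sortKeys K
  let s ← forList order (S₁, ([] : List Window)) fun key (S, P) => visit key S P
  return s.2

theorem partitionKeys_fits (n : ℕ) (K : List HKey) {ℓ : ℕ}
    (hℓ : Nat.log 2 (K.length + 3) + 1 ≤ ℓ) :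
    (partitionKeys n K).Fits (K.length * (477 * ℓ) + 400 * ℓ) (7 * K.length + 20) 0 0 := by
  set S₀ := (AVL.insertAt AVL.nil 0 ((0, 0) : ℕ × ℕ)).val
  have hht_nil : (AVL.nil : AVL (ℕ × ℕ)).ht = 0 := rfl
  have hS₀ : S₀.WF := (AVL.insertAt_wf .nil _ _).1
  have hsz₀ : S₀.sz = 1 := AVL.sz_insertAt .nil _ _
  have hht₀ := hS₀.ht_le_sz
  set S₁ := (AVL.insertAt S₀ 1 (n + 1, n + 1)).val
  have hS₁ : S₁.WF := (AVL.insertAt_wf hS₀ _ _).1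
  have hsz₁ : S₁.sz = 2 := (AVL.sz_insertAt hS₀ _ _).trans (by rw [hsz₀])
  have hlog : Nat.log 2 (K.length + 1) ≤ Nat.log 2 (K.length + 3) :=
    Nat.log_mono_right (by omega)
  obtain ⟨hlen, hsort⟩ := sortKeys_spec (K := K) (ℓ := ℓ) (by omega)
  have hloop := mainLoop_fits hS₁ (sortKeys K).val [] (ℓ := ℓ)
    (by rw [hsz₁, hlen, show 2 + K.length + 1 = K.length + 3 by omega]; exact hℓ)
  rw [hsz₁, hlen] at hloop
  have hsteps : K.length * (76 * ℓ) + K.length * (400 * ℓ + 1) ≤ K.length * (477 * ℓ) := by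
    rw [← mul_add]
    exact Nat.mul_le_mul_left _ (by omega)
  refine (step_bind_fits_iff _ _).2 <| (AVL.insertAt_fits .nil 0 (0, 0)).bind_of
    (u := K.length * (477 * ℓ) + 300 * ℓ + 65) (d := 7 * K.length + 15) (u' := 0) (d' := 0) ?_
    (by omega) (by omega) (by omega) (by omega)
  refine (AVL.insertAt_fits hS₀ 1 (n + 1, n + 1)).bind_of
    (u := K.length * (477 * ℓ) + 200 * ℓ + 3) (d := 7 * K.length + 10) (u' := 0) (d' := 0) ?_
    (by omega) (by omega) (by omega) (by omega)
  refine hsort.bind_of ((bind_pure_fits_iff _ _).2 hloop)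
    (by omega) (by omega) (by omega) (by omega)

section Algorithm

variable {α : Type} {T : List α} {h : α → ℕ → ℕ} {N ℓ : ℕ}

theorem monotonicPartitioning_eq (gen : List α → (α → ℕ → ℕ) → Run (List HKey)) :
    monotonicPartitioning gen T h = (do
      alloc T.length
      let K ← gen T h
      partitionKeys T.length K) := rfl

theorem monotonicPartitioning_fits {gen : List α → (α → ℕ → ℕ) → Run (List HKey)}
    (hgen : (gen T h).val.length ≤ N ∧ (gen T h).Fits
      (100 * ((T.length + 1) * ℓ) + (8 * T.length + 8 * N + 1)) (4 * T.length + N) 0 T.length)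
    (hT : 1 ≤ T.length) (hTN : T.length ≤ N) (hℓ : Nat.log 2 (N + 3) + 1 ≤ ℓ) :
    (monotonicPartitioning gen T h).Fits (1200 * (N * ℓ)) (40 * N) 0 0 := by
  obtain ⟨hlen, hfits⟩ := hgen
  have hlog : Nat.log 2 ((gen T h).val.length + 3) ≤ Nat.log 2 (N + 3) :=
    Nat.log_mono_right (by omega)
  have hpart := partitionKeys_fits T.length (gen T h).val (ℓ := ℓ) (by omega)
  have hkeys : (gen T h).val.length * (477 * ℓ) ≤ 477 * (N * ℓ) := by
    nlinarith [Nat.mul_le_mul_right ℓ hlen]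
  have hindex : (T.length + 1) * ℓ ≤ 2 * (N * ℓ) := by nlinarith
  have hN : N ≤ N * ℓ := Nat.le_mul_of_pos_right N (by omega)
  have hℓN : ℓ ≤ N * ℓ := Nat.le_mul_of_pos_left ℓ (by omega)
  rw [monotonicPartitioning_eq]
  refine (alloc_fits (t := 0) (c := 0) T.length).bind_of
    (u := 1100 * (N * ℓ)) (d := 39 * N) (u' := 0) (d' := 0) ?_
    (by omega) (by omega) (by omega) (by omega)
  exact hfits.bind_of hpart (by omega) (by omega) (by omega) (by omega)

end Algorithm

/-! ### Counting active keys -/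

section Spans

variable {α : Type} {t : α} {h : α → ℕ → ℕ} {r x m : ℕ}

/-- The active keys of a token `t` with `m` occurrences, as pairs of the number `x` of occurrences
they span and the number `r` of occurrences before them. -/
noncomputable def activeSpans (h : α → ℕ → ℕ) (t : α) (m : ℕ) : Finset (Σ _ : ℕ, ℕ) :=
  (Finset.Ico 1 (m + 1)).sigma fun x => Finset.range (activeWeight h t m x)

theorem card_activeSpans : (activeSpans h t m).card = activeCount h t m := by
  simp only [activeSpans, activeCount, Finset.card_sigma, Finset.card_range]

theorem mem_activeSpans :
    ⟨x, r⟩ ∈ activeSpans h t m ↔ IsActiveHash h t x ∧ 1 ≤ x ∧ r + x ≤ m := by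
  by_cases hact : IsActiveHash h t x
  · simp only [activeSpans, activeWeight, hact, if_true, Finset.mem_sigma, Finset.mem_Ico,
      Finset.mem_range, true_and]
    omega
  · simp [activeSpans, activeWeight, hact]

end Spans

section Counting

variable {α : Type} [LinearOrder α] {T : List α} {t : α} {h : α → ℕ → ℕ} {p q r x : ℕ}

theorem getElem?_idxOfNth (hr : r < T.count t) : T[T.idxOfNth t r]? = some t :=
  List.getElem?_eq_some_iff.2 ⟨List.idxOfNth_lt_length_of_lt_count hr, List.getElem_idxOfNth_eq⟩

theorem idxOfNth_countBefore (hp : T[p]? = some t) : T.idxOfNth t (T.countBefore t p) = p := by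
  obtain ⟨_, hget⟩ := List.getElem?_eq_some_iff.1 hp
  exact List.idxOfNth_countBefore_of_lt_length_of_beq (beq_iff_eq.2 hget)

theorem idxOfNth_inj {t' : α} {r' : ℕ} (hr : r < T.count t) (hr' : r' < T.count t')
    (heq : T.idxOfNth t r = T.idxOfNth t' r') : t = t' ∧ r = r' := by
  have hget := getElem?_idxOfNth hr
  rw [heq, getElem?_idxOfNth hr', Option.some_inj] at hget
  subst hget
  exact ⟨rfl, (List.idxOfNth_eq_idxOfNth_iff_of_left_lt_count hr).1 heq⟩

theorem countBefore_succ (hp : T[p]? = some t) :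
    T.countBefore t (p + 1) = T.countBefore t p + 1 := by
  rw [List.countBefore_eq_count_take, List.countBefore_eq_count_take, List.take_add_one, hp]
  simp

theorem countBefore_add_count_slice (hpq : p ≤ q) :
    T.countBefore t p + (slice T (p + 1) q).count t = T.countBefore t q := by
  rw [List.countBefore_eq_count_take, List.countBefore_eq_count_take, slice, Nat.add_sub_cancel,
    ← min_eq_left hpq, ← List.take_take, ← List.count_append, min_eq_left hpq,
    List.take_append_drop]

theorem count_slice_idxOfNth (hx : 1 ≤ x) (hrx : r + x ≤ T.count t) :
    (slice T (T.idxOfNth t r + 1) (T.idxOfNth t (r + x - 1) + 1)).count t = x := by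
  have hle : T.idxOfNth t r ≤ T.idxOfNth t (r + x - 1) := List.idxOfNth_mono (by omega)
  have hslice := countBefore_add_count_slice (T := T) (t := t) (Nat.le_add_right_of_le (k := 1) hle)
  rw [countBefore_succ (getElem?_idxOfNth (by omega)),
    List.countBefore_idxOfNth_of_lt_count (by omega),
    List.countBefore_idxOfNth_of_lt_count (by omega)] at hslice
  omega

theorem isActiveKey_iff : IsActiveKey T h p q ↔ ∃ t x r, IsActiveHash h t x ∧ 1 ≤ x ∧
    r + x ≤ T.count t ∧ T.idxOfNth t r + 1 = p ∧ T.idxOfNth t (r + x - 1) + 1 = q := by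
  constructor
  · rintro ⟨⟨hp, hpq, -, heq⟩, t, hq, hact⟩
    obtain ⟨p, rfl⟩ := Nat.exists_eq_add_of_le' hp
    obtain ⟨q, rfl⟩ := Nat.exists_eq_add_of_le' (hp.trans hpq)
    rw [Nat.add_sub_cancel] at heq hq
    have hslice := countBefore_add_count_slice (T := T) (t := t) (p := p) (q := q + 1) (by omega)
    have hsucc := countBefore_succ hq
    have hmono : T.countBefore t p ≤ T.countBefore t q := List.countPBefore_mono (by omega)
    have hcount : T.countBefore t (q + 1) ≤ T.count t := List.countBefore_le_count
    refine ⟨t, _, T.countBefore t p, hact, by omega, by omega, ?_, ?_⟩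
    · rw [idxOfNth_countBefore (heq.trans hq)]
    · rw [hslice, hsucc, Nat.add_sub_cancel, idxOfNth_countBefore hq]
  · rintro ⟨t, x, r, hact, hx, hrx, rfl, rfl⟩
    have hp := getElem?_idxOfNth (T := T) (t := t) (r := r) (by omega)
    have hq := getElem?_idxOfNth (T := T) (t := t) (r := r + x - 1) (by omega)
    have hlt := (List.getElem?_eq_some_iff.1 hq).1
    have hle : T.idxOfNth t r ≤ T.idxOfNth t (r + x - 1) := List.idxOfNth_mono (by omega)
    refine ⟨⟨by omega, by omega, by omega, hp.trans hq.symm⟩, t, hq, ?_⟩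
    rwa [count_slice_idxOfNth hx hrx]

theorem mem_activeKeys : (p, q) ∈ activeKeys T h ↔ IsActiveKey T h p q := by
  simp only [activeKeys, Finset.mem_filter, Finset.mem_product, Finset.mem_Icc,
    and_iff_right_iff_imp]
  rintro ⟨⟨hp, hpq, hq, -⟩, -⟩
  omega

theorem card_activeKeys :
    (activeKeys T h).card = ∑ t ∈ T.toFinset, activeCount h t (T.count t) := by
  simp only [← card_activeSpans, ← Finset.card_sigma]
  refine (Finset.card_nbij (fun e => (T.idxOfNth e.1 e.2.2 + 1,
    T.idxOfNth e.1 (e.2.2 + e.2.1 - 1) + 1)) ?_ ?_ ?_).symm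
  · rintro ⟨t, x, r⟩ he
    obtain ⟨-, he⟩ := Finset.mem_sigma.1 he
    obtain ⟨hact, hx, hrx⟩ := mem_activeSpans.1 he
    exact mem_activeKeys.2 (isActiveKey_iff.2 ⟨t, x, r, hact, hx, hrx, rfl, rfl⟩)
  · rintro ⟨t, x, r⟩ he ⟨t', x', r'⟩ he' heq
    obtain ⟨-, hx, hrx : r + x ≤ T.count t⟩ := mem_activeSpans.1 (Finset.mem_sigma.1 he).2
    obtain ⟨-, hx', hrx' : r' + x' ≤ T.count t'⟩ :=
      mem_activeSpans.1 (Finset.mem_sigma.1 he').2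
    obtain ⟨hp, hq⟩ := Prod.mk.inj heq
    replace hp : T.idxOfNth t r = T.idxOfNth t' r' := Nat.succ_injective hp
    replace hq : T.idxOfNth t (r + x - 1) = T.idxOfNth t' (r' + x' - 1) := Nat.succ_injective hq
    obtain ⟨rfl, rfl⟩ := idxOfNth_inj (by omega) (by omega) hp
    obtain ⟨-, hr⟩ := idxOfNth_inj (by omega) (by omega) hq
    obtain rfl : x = x' := by omega
    rfl
  · rintro ⟨p, q⟩ hpq
    obtain ⟨t, x, r, hact, hx, hrx, rfl, rfl⟩ := isActiveKey_iff.1 (mem_activeKeys.1 hpq)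
    have ht : t ∈ T := List.count_pos_iff.1 (by omega)
    exact ⟨⟨t, x, r⟩, Finset.mem_sigma.2
      ⟨List.mem_toFinset.2 ht, mem_activeSpans.2 ⟨hact, hx, hrx⟩⟩, rfl⟩

theorem length_le_card_activeKeys (T : List α) (h : α → ℕ → ℕ) :
    T.length ≤ (activeKeys T h).card := by
  rw [card_activeKeys, ← List.sum_toFinset_count_eq_length]
  refine Finset.sum_le_sum fun t ht => ?_
  have hpos : 0 < T.count t := List.count_pos_iff.2 (List.mem_toFinset.1 ht)
  have hone : IsActiveHash h t 1 := fun x' _ _ => by omega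
  calc T.count t = activeWeight h t (T.count t) 1 := by rw [activeWeight, if_pos hone]; rfl
    _ ≤ activeCount h t (T.count t) :=
      Finset.single_le_sum (f := activeWeight h t (T.count t)) (fun _ _ => Nat.zero_le _)
        (Finset.mem_Ico.2 ⟨le_rfl, by omega⟩)

theorem card_activeKeys_le (T : List α) (h : α → ℕ → ℕ) :
    (activeKeys T h).card ≤ T.length ^ 2 := by
  classical
  exact (Finset.card_filter_le _ _).trans_eq
    (by rw [Finset.card_product, Nat.card_Icc, Nat.add_sub_cancel, sq])

theorem count_le_maxFreq (ht : t ∈ T) : T.count t ≤ maxFreq T :=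
  Finset.le_sup (f := fun t => T.count t) (List.mem_toFinset.2 ht)

theorem maxFreq_le_length (T : List α) : maxFreq T ≤ T.length :=
  Finset.sup_le fun _ _ => List.count_le_length

theorem one_le_maxFreq (hT : 1 ≤ T.length) : 1 ≤ maxFreq T := by
  obtain ⟨t, ht⟩ := List.exists_mem_of_length_pos hT
  exact (List.count_pos_iff.2 ht).trans_le (count_le_maxFreq ht)

theorem sum_count_mul_self_le (T : List α) :
    ∑ t ∈ T.toFinset, T.count t * T.count t ≤ T.length * maxFreq T := by
  rw [← List.sum_toFinset_count_eq_length, Finset.sum_mul]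
  exact Finset.sum_le_sum fun t ht =>
    Nat.mul_le_mul_left _ (count_le_maxFreq (List.mem_toFinset.1 ht))

end Counting

/-! ### Exchangeable families -/

section Exchangeable

variable {ι E : Type*}

/-- The vectors whose unique smallest coordinate is `i`. -/
def uniqueMin [LT E] (i : ι) : Set (ι → E) := {v | ∀ j ≠ i, v i < v j}

theorem pairwise_disjoint_uniqueMin [Preorder E] :
    Pairwise (Function.onFun Disjoint (uniqueMin : ι → Set (ι → E))) := fun _ _ hij =>
  Set.disjoint_left.2 fun _ hi hj => lt_asymm (hi _ hij.symm) (hj _ hij)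

theorem comp_mem_uniqueMin_iff [LT E] (σ : Equiv.Perm ι) {v : ι → E} {i : ι} :
    v ∘ σ ∈ uniqueMin i ↔ v ∈ uniqueMin (σ i) :=
  σ.forall_congr fun j => by simp

variable {Ω κ : Type*} [MeasurableSpace Ω] {μ : Measure Ω} [MeasurableSpace E]

/-- A random family `V` is exchangeable if its joint law is invariant under permutations of the
index set. -/
def IsExchangeable (μ : Measure Ω) (V : Ω → ι → E) : Prop :=
  ∀ σ : Equiv.Perm ι, IdentDistrib V (fun ω i => V ω (σ i)) μ μ

theorem IsExchangeable.aemeasurable {V : Ω → ι → E} (hV : IsExchangeable μ V) :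
    AEMeasurable V μ := (hV 1).aemeasurable_fst

theorem IsExchangeable.comp_injective {V : Ω → ι → E} (hV : IsExchangeable μ V) {a : κ → ι}
    (ha : Function.Injective a) : IsExchangeable μ fun ω j => V ω (a j) := fun σ => by
  have hlaw := (hV (σ.viaEmbedding ⟨a, ha⟩)).comp (u := fun v j => v (a j)) (by fun_prop)
  have hσ (j : κ) : σ.viaEmbedding ⟨a, ha⟩ (a j) = a (σ j) := σ.viaEmbedding_apply ⟨a, ha⟩ j
  simpa only [Function.comp_def, hσ] using hlaw

variable [LinearOrder E] [TopologicalSpace E] [OrderClosedTopology E] [SecondCountableTopology E]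
  [OpensMeasurableSpace E]

theorem measurableSet_uniqueMin [Countable ι] (i : ι) :
    MeasurableSet (uniqueMin i : Set (ι → E)) := by
  simp only [uniqueMin, Set.ofPred_forall]
  exact .iInter fun j => .iInter fun _ =>
    measurableSet_lt (measurable_pi_apply i) (measurable_pi_apply j)

-- The events that the coordinate `j` is the unique minimum are disjoint and equally likely.
theorem IsExchangeable.card_mul_measure_uniqueMin_le [Fintype ι] {V : Ω → ι → E}
    (hV : IsExchangeable μ V) (i : ι) :
    Fintype.card ι * μ (V ⁻¹' uniqueMin i) ≤ μ Set.univ := by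
  classical
  have hmeas (j : ι) : NullMeasurableSet (V ⁻¹' uniqueMin j) μ :=
    hV.aemeasurable.nullMeasurableSet_preimage (measurableSet_uniqueMin j)
  have heq (j : ι) : μ (V ⁻¹' uniqueMin j) = μ (V ⁻¹' uniqueMin i) := by
    rw [(hV (Equiv.swap i j)).measure_mem_eq (measurableSet_uniqueMin i)]
    refine congrArg μ (Set.ext fun ω => ?_)
    rw [Set.mem_preimage, Set.mem_preimage, ← Function.comp_def (V ω), comp_mem_uniqueMin_iff,
      Equiv.swap_apply_left]
  have hdisj : Pairwise (Function.onFun (AEDisjoint μ) fun j => V ⁻¹' uniqueMin j) := fun j k hjk =>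
    ((pairwise_disjoint_uniqueMin hjk).preimage V).aedisjoint
  calc Fintype.card ι * μ (V ⁻¹' uniqueMin i) = ∑ j, μ (V ⁻¹' uniqueMin j) := by
        simp only [heq, Finset.sum_const, Finset.card_univ, nsmul_eq_mul]
    _ = μ (⋃ j, V ⁻¹' uniqueMin j) := by rw [measure_iUnion₀ hdisj hmeas, tsum_fintype]
    _ ≤ μ Set.univ := measure_mono (Set.subset_univ _)

end Exchangeable

/-! ### The expected number of active keys -/

section Expectation

variable {α : Type} {t : α} {m x : ℕ}

theorem isActiveHash_succ_iff {h : α → ℕ → ℕ} : IsActiveHash h t (x + 1) ↔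
    (fun j : Fin (x + 1) => h t (j + 1)) ∈ uniqueMin (Fin.last x) := by
  constructor
  · intro hact j hj
    have := Fin.val_lt_last hj
    exact hact _ (by omega) (by omega)
  · intro hmin x' hx' hlt
    obtain ⟨j, rfl⟩ := Nat.exists_eq_add_of_le' hx'
    exact hmin ⟨j, by omega⟩ (Fin.ne_of_lt (Fin.lt_def.2 (Nat.lt_of_succ_lt_succ hlt)))

variable {Ω : Type*} {H : Ω → α → ℕ → ℕ}

theorem cast_activeWeight (ω : Ω) : (activeWeight (H ω) t m x : ENNReal) =
    {ω | IsActiveHash (H ω) t x}.indicator (fun _ => ((m + 1 - x : ℕ) : ENNReal)) ω := by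
  rw [activeWeight, Nat.cast_ite, Nat.cast_zero]
  rfl

variable [MeasurableSpace Ω] {μ : Measure Ω}

section Token

variable (hH : IsExchangeable μ fun ω (i : Fin m) => H ω t (i + 1)) (hx : x ∈ Finset.Ico 1 (m + 1))
include hH hx

theorem exists_isExchangeable_preimage_uniqueMin : ∃ (V : Ω → Fin x → ℕ) (i : Fin x),
    IsExchangeable μ V ∧ {ω | IsActiveHash (H ω) t x} = V ⁻¹' uniqueMin i := by
  obtain ⟨hx, hxm⟩ := Finset.mem_Ico.1 hx
  obtain ⟨x, rfl⟩ := Nat.exists_eq_add_of_le' hx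
  exact ⟨_, Fin.last x, hH.comp_injective (Fin.castLE_injective (Nat.le_of_lt_succ hxm)),
    Set.ext fun ω => isActiveHash_succ_iff⟩

theorem nullMeasurableSet_isActiveHash : NullMeasurableSet {ω | IsActiveHash (H ω) t x} μ := by
  obtain ⟨V, i, hV, heq⟩ := exists_isExchangeable_preimage_uniqueMin hH hx
  rw [heq]
  exact hV.aemeasurable.nullMeasurableSet_preimage (measurableSet_uniqueMin i)

theorem aemeasurable_activeWeight :
    AEMeasurable (fun ω => (activeWeight (H ω) t m x : ENNReal)) μ := by
  simp only [cast_activeWeight]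
  exact aemeasurable_const.indicator₀ (nullMeasurableSet_isActiveHash hH hx)

theorem measure_isActiveHash_le [IsProbabilityMeasure μ] :
    μ {ω | IsActiveHash (H ω) t x} ≤ (x : ENNReal)⁻¹ := by
  obtain ⟨V, i, hV, heq⟩ := exists_isExchangeable_preimage_uniqueMin hH hx
  rw [ENNReal.le_inv_iff_mul_le, mul_comm, heq]
  simpa using hV.card_mul_measure_uniqueMin_le i

end Token

theorem aemeasurable_activeCount
    (hH : IsExchangeable μ fun ω (i : Fin m) => H ω t (i + 1)) :
    AEMeasurable (fun ω => (activeCount (H ω) t m : ENNReal)) μ := by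
  simp only [activeCount, Nat.cast_sum]
  exact Finset.aemeasurable_fun_sum _ fun x hx => aemeasurable_activeWeight hH hx

theorem sum_Ico_mul_inv_le (m : ℕ) :
    ∑ x ∈ Finset.Ico 1 (m + 1), (m : ℝ) * (x : ℝ)⁻¹ ≤ m * (1 + Real.log m) := by
  rw [← Finset.mul_sum]
  have hharmonic := harmonic_le_one_add_log m
  rw [harmonic_eq_sum_Icc] at hharmonic
  push_cast at hharmonic
  exact mul_le_mul_of_nonneg_left hharmonic (Nat.cast_nonneg m)

section Token

variable [IsProbabilityMeasure μ] (hH : IsExchangeable μ fun ω (i : Fin m) => H ω t (i + 1))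
include hH

theorem lintegral_activeWeight_le (hx : x ∈ Finset.Ico 1 (m + 1)) :
    ∫⁻ ω, (activeWeight (H ω) t m x : ENNReal) ∂μ ≤ ENNReal.ofReal (m * (x : ℝ)⁻¹) := by
  have hpos : (0 : ℝ) < x := Nat.cast_pos.2 (Finset.mem_Ico.1 hx).1
  have hle : ((m + 1 - x : ℕ) : ENNReal) ≤ m := by
    have := (Finset.mem_Ico.1 hx).1
    exact_mod_cast (by omega : m + 1 - x ≤ m)
  calc ∫⁻ ω, (activeWeight (H ω) t m x : ENNReal) ∂μ
      = (m + 1 - x : ℕ) * μ {ω | IsActiveHash (H ω) t x} := by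
        rw [← lintegral_indicator_const₀ (nullMeasurableSet_isActiveHash hH hx)]
        simp only [cast_activeWeight]
    _ ≤ m * (x : ENNReal)⁻¹ := mul_le_mul' hle (measure_isActiveHash_le hH hx)
    _ = ENNReal.ofReal (m * (x : ℝ)⁻¹) := by
        rw [ENNReal.ofReal_mul (Nat.cast_nonneg m), ENNReal.ofReal_inv_of_pos hpos,
          ENNReal.ofReal_natCast, ENNReal.ofReal_natCast]

theorem lintegral_activeCount_le :
    ∫⁻ ω, (activeCount (H ω) t m : ENNReal) ∂μ ≤ ENNReal.ofReal (m * (1 + Real.log m)) := by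
  calc ∫⁻ ω, (activeCount (H ω) t m : ENNReal) ∂μ
      = ∑ x ∈ Finset.Ico 1 (m + 1), ∫⁻ ω, (activeWeight (H ω) t m x : ENNReal) ∂μ := by
        simp only [activeCount, Nat.cast_sum]
        exact lintegral_finsetSum' _ fun x hx => aemeasurable_activeWeight hH hx
    _ ≤ ∑ x ∈ Finset.Ico 1 (m + 1), ENNReal.ofReal (m * (x : ℝ)⁻¹) :=
        Finset.sum_le_sum fun x hx => lintegral_activeWeight_le hH hx
    _ = ENNReal.ofReal (∑ x ∈ Finset.Ico 1 (m + 1), m * (x : ℝ)⁻¹) :=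
        (ENNReal.ofReal_sum_of_nonneg fun x _ => by positivity).symm
    _ ≤ ENNReal.ofReal (m * (1 + Real.log m)) := ENNReal.ofReal_le_ofReal (sum_Ico_mul_inv_le m)

end Token

variable [LinearOrder α] {T : List α}

theorem lintegral_card_activeKeys_le [IsProbabilityMeasure μ]
    (hH : ∀ t ∈ T, IsExchangeable μ fun ω (i : Fin (T.count t)) => H ω t (i + 1)) :
    ∫⁻ ω, ((activeKeys T (H ω)).card : ENNReal) ∂μ ≤
      ENNReal.ofReal (T.length * (1 + Real.log (maxFreq T))) := by
  have hlog : 0 ≤ Real.log (maxFreq T) := Real.log_natCast_nonneg _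
  have htoken : ∀ t ∈ T.toFinset, ∫⁻ ω, (activeCount (H ω) t (T.count t) : ENNReal) ∂μ ≤
      ENNReal.ofReal (T.count t * (1 + Real.log (maxFreq T))) := fun t ht => by
    have ht := List.mem_toFinset.1 ht
    have hpos : (0 : ℝ) < T.count t := Nat.cast_pos.2 (List.count_pos_iff.2 ht)
    have hle : (T.count t : ℝ) ≤ maxFreq T := Nat.cast_le.2 (count_le_maxFreq ht)
    refine (lintegral_activeCount_le (hH t ht)).trans (ENNReal.ofReal_le_ofReal ?_)
    gcongr
  calc ∫⁻ ω, ((activeKeys T (H ω)).card : ENNReal) ∂μ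
      = ∑ t ∈ T.toFinset, ∫⁻ ω, (activeCount (H ω) t (T.count t) : ENNReal) ∂μ := by
        simp only [card_activeKeys, Nat.cast_sum]
        exact lintegral_finsetSum' _ fun t ht =>
          aemeasurable_activeCount (hH t (List.mem_toFinset.1 ht))
    _ ≤ ∑ t ∈ T.toFinset, ENNReal.ofReal (T.count t * (1 + Real.log (maxFreq T))) :=
        Finset.sum_le_sum htoken
    _ = ENNReal.ofReal (T.length * (1 + Real.log (maxFreq T))) := by
        rw [← ENNReal.ofReal_sum_of_nonneg fun t _ => mul_nonneg (Nat.cast_nonneg _)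
          (add_nonneg zero_le_one hlog), ← Finset.sum_mul,
          ← Nat.cast_sum, List.sum_toFinset_count_eq_length]

theorem IsRandomHash.isExchangeable (hH : IsRandomHash μ T H) {t : α} (ht : t ∈ T) :
    IsExchangeable μ fun ω (i : Fin (T.count t)) => H ω t (i + 1) :=
  IsExchangeable.comp_injective (V := fun ω (e : hashArgs T) => H ω e.1.1 e.1.2) hH.exchangeable
    (a := fun i : Fin (T.count t) => ⟨(t, i + 1), ht, by omega, i.2⟩) fun i j hij => by
      have hval : (t, (i : ℕ) + 1) = (t, (j : ℕ) + 1) := congrArg Subtype.val hij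
      exact Fin.ext (Nat.succ_injective (Prod.ext_iff.1 hval).2)

end Expectation

/-! ### The final bounds -/

section Bounds

theorem natLog_pow_four_add_one_le {n : ℕ} (hn : 2 ≤ n) :
    ((Nat.log 2 (n ^ 4) + 1 : ℕ) : ℝ) ≤ 10 * Real.log n := by
  have htwo : (0.5 : ℝ) < Real.log 2 := by linarith [Real.log_two_gt_d9]
  have hlog : Real.log 2 ≤ Real.log n := Real.log_le_log (by norm_num) (by exact_mod_cast hn)
  have hpow : (2 : ℝ) ^ Nat.log 2 (n ^ 4) ≤ (n : ℝ) ^ 4 := by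
    exact_mod_cast Nat.pow_log_le_self 2 (pow_ne_zero 4 (by omega))
  have hmul : (Nat.log 2 (n ^ 4) : ℝ) * Real.log 2 ≤ 4 * Real.log n := by
    simpa only [Real.log_pow, Nat.cast_ofNat] using Real.log_le_log (by positivity) hpow
  have hnonneg : (0 : ℝ) ≤ Nat.log 2 (n ^ 4) := Nat.cast_nonneg _
  push_cast
  nlinarith [hnonneg]

variable {α : Type} {T : List α} {N : ℕ}

theorem monotonicPartitioning_time_peak_le {gen : List α → (α → ℕ → ℕ) → Run (List HKey)}
    (hT : 2 ≤ T.length) (hTN : T.length ≤ N) (hN : N ≤ T.length ^ 2)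
    (hgen : ∀ {ℓ}, Nat.log 2 (T.length + 1) + 1 ≤ ℓ → (gen T h).val.length ≤ N ∧ (gen T h).Fits
      (100 * ((T.length + 1) * ℓ) + (8 * T.length + 8 * N + 1)) (4 * T.length + N) 0 T.length) :
    ((monotonicPartitioning gen T h).time : ℝ) ≤ 12000 * (N * Real.log T.length) ∧
      ((monotonicPartitioning gen T h).peak : ℝ) ≤ 12000 * N := by
  have hpow : N + 3 ≤ T.length ^ 4 := by nlinarith
  have hfits := monotonicPartitioning_fits (ℓ := Nat.log 2 (T.length ^ 4) + 1)
    (hgen (Nat.add_le_add_right (Nat.log_mono_right (by omega)) 1)) (by omega) hTN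
    (Nat.add_le_add_right (Nat.log_mono_right hpow) 1)
  have hlog := natLog_pow_four_add_one_le hT
  constructor
  · calc ((monotonicPartitioning gen T h).time : ℝ)
        ≤ 1200 * (N * ((Nat.log 2 (T.length ^ 4) + 1 : ℕ) : ℝ)) := by exact_mod_cast hfits.time_le
      _ ≤ 1200 * (N * (10 * Real.log T.length)) := by gcongr
      _ = 12000 * (N * Real.log T.length) := by ring
  · calc ((monotonicPartitioning gen T h).peak : ℝ) ≤ 40 * N := by exact_mod_cast hfits.peak_le
      _ ≤ 12000 * N := by gcongr; norm_num

variable [LinearOrder α]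

theorem monoActive_time_peak_le (hT : 2 ≤ T.length) (h : α → ℕ → ℕ) :
    ((monoActive T h).time : ℝ) ≤ 12000 * ((activeKeys T h).card * Real.log T.length) ∧
      ((monoActive T h).peak : ℝ) ≤ 12000 * (activeKeys T h).card :=
  monotonicPartitioning_time_peak_le hT (length_le_card_activeKeys T h) (card_activeKeys_le T h)
    (generateActiveKeys_spec card_activeKeys.ge)

theorem monoAll_time_peak_le (hT : 2 ≤ T.length) (h : α → ℕ → ℕ) :
    ((monoAll T h).time : ℝ) ≤ 12000 * (T.length * maxFreq T * Real.log T.length) ∧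
      ((monoAll T h).peak : ℝ) ≤ 12000 * (T.length * maxFreq T) := by
  have hlength : T.length ≤ T.length * maxFreq T :=
    Nat.le_mul_of_pos_right _ (one_le_maxFreq (by omega))
  have hsq : T.length * maxFreq T ≤ T.length ^ 2 :=
    (Nat.mul_le_mul_left _ (maxFreq_le_length T)).trans_eq (sq _).symm
  exact_mod_cast monotonicPartitioning_time_peak_le hT hlength hsq
    (generateKeys_spec (sum_count_mul_self_le T))

variable {Ω : Type*} [MeasurableSpace Ω] {μ : Measure Ω} [IsProbabilityMeasure μ]
  {H : Ω → α → ℕ → ℕ}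

theorem lintegral_le_of_le_card_activeKeys
    (hH : ∀ t ∈ T, IsExchangeable μ fun ω (i : Fin (T.count t)) => H ω t (i + 1))
    {c : ℝ} (hc : 0 ≤ c) {g : Ω → ℕ} (hg : ∀ ω, (g ω : ℝ) ≤ c * (activeKeys T (H ω)).card) :
    ∫⁻ ω, (g ω : ENNReal) ∂μ ≤ ENNReal.ofReal (c * (T.length * (1 + Real.log (maxFreq T)))) := by
  have hpoint (ω : Ω) : (g ω : ENNReal) ≤ ENNReal.ofReal c * (activeKeys T (H ω)).card := by
    simpa only [ENNReal.ofReal_mul hc, ENNReal.ofReal_natCast] using ENNReal.ofReal_le_ofReal (hg ω)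
  calc ∫⁻ ω, (g ω : ENNReal) ∂μ
      ≤ ∫⁻ ω, ENNReal.ofReal c * ((activeKeys T (H ω)).card : ENNReal) ∂μ := lintegral_mono hpoint
    _ = ENNReal.ofReal c * ∫⁻ ω, ((activeKeys T (H ω)).card : ENNReal) ∂μ :=
        lintegral_const_mul' _ _ ENNReal.ofReal_ne_top
    _ ≤ ENNReal.ofReal c * ENNReal.ofReal (T.length * (1 + Real.log (maxFreq T))) := by
        gcongr
        exact lintegral_card_activeKeys_le hH
    _ = _ := (ENNReal.ofReal_mul hc).symm

theorem lintegral_monoActive_time_le (hT : 2 ≤ T.length)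
    (hH : ∀ t ∈ T, IsExchangeable μ fun ω (i : Fin (T.count t)) => H ω t (i + 1)) :
    ∫⁻ ω, ((monoActive T (H ω)).time : ENNReal) ∂μ ≤ ENNReal.ofReal (12000 *
      (T.length * Real.log T.length + T.length * Real.log T.length * Real.log (maxFreq T))) := by
  have htime (ω : Ω) : ((monoActive T (H ω)).time : ℝ) ≤
      12000 * Real.log T.length * (activeKeys T (H ω)).card :=
    (monoActive_time_peak_le hT (H ω)).1.trans_eq (by ring)
  have hlog : 0 ≤ Real.log T.length := Real.log_natCast_nonneg _
  refine (lintegral_le_of_le_card_activeKeys hH (mul_nonneg (by norm_num) hlog) htime).trans_eq ?_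
  congr 1
  ring

theorem lintegral_monoActive_peak_le (hT : 2 ≤ T.length)
    (hH : ∀ t ∈ T, IsExchangeable μ fun ω (i : Fin (T.count t)) => H ω t (i + 1)) :
    ∫⁻ ω, ((monoActive T (H ω)).peak : ENNReal) ∂μ ≤
      ENNReal.ofReal (12000 * (T.length + T.length * Real.log (maxFreq T))) := by
  refine (lintegral_le_of_le_card_activeKeys hH (by norm_num)
    fun ω => (monoActive_time_peak_le hT (H ω)).2).trans_eq ?_
  congr 1
  ring

end Bounds

end TextAlign

theorem theorem4_general :
    ∃ C : ℝ, 0 < C ∧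
      ∀ (α : Type) [LinearOrder α] (T : List α), 2 ≤ T.length →
        (∀ h : α → ℕ → ℕ,
          ((TextAlign.monoActive T h).time : ℝ) ≤
              C * ((TextAlign.activeKeys T h).card * Real.log T.length) ∧
          ((TextAlign.monoActive T h).peak : ℝ) ≤ C * (TextAlign.activeKeys T h).card) ∧
        (∀ (Ω : Type*) [MeasurableSpace Ω] (μ : Measure Ω) [IsProbabilityMeasure μ]
          (H : Ω → α → ℕ → ℕ),
          (∀ t ∈ T, TextAlign.IsExchangeable μ fun ω (i : Fin (T.count t)) => H ω t (i + 1)) →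
          ∫⁻ ω, ((TextAlign.monoActive T (H ω)).time : ENNReal) ∂μ ≤
              ENNReal.ofReal (C * (T.length * Real.log T.length +
                T.length * Real.log T.length * Real.log (TextAlign.maxFreq T))) ∧
          ∫⁻ ω, ((TextAlign.monoActive T (H ω)).peak : ENNReal) ∂μ ≤
              ENNReal.ofReal (C * (T.length + T.length * Real.log (TextAlign.maxFreq T)))) ∧
        (∀ h : α → ℕ → ℕ,
          ((TextAlign.monoAll T h).time : ℝ) ≤
              C * (T.length * TextAlign.maxFreq T * Real.log T.length) ∧
          ((TextAlign.monoAll T h).peak : ℝ) ≤ C * (T.length * TextAlign.maxFreq T)) :=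
  ⟨12000, by norm_num, fun _ _ _ hT => ⟨TextAlign.monoActive_time_peak_le hT,
    fun _ _ _ _ _ hH => ⟨TextAlign.lintegral_monoActive_time_le hT hH,
      TextAlign.lintegral_monoActive_peak_le hT hH⟩,
    TextAlign.monoAll_time_peak_le hT⟩⟩

theorem theorem4 :
    ∃ C : ℝ, 0 < C ∧
      ∀ (α : Type) [LinearOrder α] (T : List α) (n f : ℕ),
        n = T.length → f = TextAlign.maxFreq T → 2 ≤ n →
        -- every hash function, with the active keys only
        (∀ h : α → ℕ → ℕ,
          ((TextAlign.monoActive T h).time : ℝ) ≤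
              C * ((TextAlign.activeKeys T h).card * Real.log n) ∧
          ((TextAlign.monoActive T h).peak : ℝ) ≤ C * (TextAlign.activeKeys T h).card) ∧
        -- a random hash function, in expectation
        (∀ (Ω : Type*) [MeasurableSpace Ω] (μ : MeasureTheory.Measure Ω)
          [MeasureTheory.IsProbabilityMeasure μ] (H : Ω → α → ℕ → ℕ),
          TextAlign.IsRandomHash μ T H →
          ∫⁻ ω, ((TextAlign.monoActive T (H ω)).time : ENNReal) ∂μ ≤
              ENNReal.ofReal (C * (n * Real.log n + n * Real.log n * Real.log f)) ∧
          ∫⁻ ω, ((TextAlign.monoActive T (H ω)).peak : ENNReal) ∂μ ≤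
              ENNReal.ofReal (C * (n + n * Real.log f))) ∧
        -- every hash function, with all the keys
        (∀ h : α → ℕ → ℕ,
          ((TextAlign.monoAll T h).time : ℝ) ≤ C * (n * f * Real.log n) ∧
          ((TextAlign.monoAll T h).peak : ℝ) ≤ C * (n * f)) := by
  obtain ⟨C, hC, hbounds⟩ := theorem4_general
  refine ⟨C, hC, fun α _ T n f hn hf hT => ?_⟩
  subst hn hf
  obtain ⟨hactive, hrandom, hall⟩ := hbounds α T hT
  exact ⟨hactive, fun Ω _ μ _ H hH => hrandom Ω μ H fun _ => hH.isExchangeable, hall⟩
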